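/- Let $\delta>0$ and $|\theta_0|<2^{\frac{1}{4+2\delta}-1}$. Let $W_1,W_2,\dots$ be i.i.d. standard Gaussian, let $X_0$ be independent of $(W_n)$ with law $q^{(0)}$ (given by a density with respect to some reference measure on $\mathbb R$) and $E|X_0|^{4+2\delta}<\infty$, and let $X_n=\theta_0X_{n-1}+W_n$ for $n\ge1$. For $\theta\in\Theta=(-1,1)$ let $p_\theta(y|x)$ be the density of $N(\theta x,1)$ and $q_\theta$ the density of the invariant law $N(0,\frac1{1-\theta^2})$ of the corresponding chain. Let $P^{(n)}_\theta$ be the law of $(X_0,\dots,X_n)$ under $\theta$ with initial law $q^{(0)}$, with density $p^{(n)}_\theta(x_0,\dots,x_n)=q^{(0)}(x_0)\prod_{i<n}p_\theta(x_{i+1}|x_i)$, and let $r_n(\theta,\theta_0)=\log\big(p^{(n)}_{\theta_0}/p^{(n)}_\theta\big)$. Write $\mathcal K$ for the Kullback–Leibler divergence. Let $\mathcal F$ be the set of Beta distributions (with arbitrary positive parameters) rescaled to $(-1,1)$, and $\pi$ the uniform distribution on $(-1,1)$. Then there are $\rho_n\in\mathcal F$ $(n\ge1)$ such that both of the following hold.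 (A) The process $(X_n)$ is a time-homogeneous Markov chain with transition density $p_{\theta_0}$ and initial law $q^{(0)}$. The chain is aperiodic, and there are $m\in\mathbb N$, positive measurable functions $M^{(1)}_k(x_1,x_0)$, $M^{(2)}_k(x)$, functions $f^{(1)}_k,f^{(2)}_k$ on $\Theta\times\Theta$ $(1\le k\le m)$ and a measurable $V:\mathbb R\to[1,\infty)$ with: 1. for all $\theta_1,\theta_2\in\Theta$ and all $x_0,x_1,x$: $|\log p_{\theta_1}(x_1|x_0)-\log p_{\theta_2}(x_1|x_0)|\le\sum_kM^{(1)}_k(x_1,x_0)|f^{(1)}_k(\theta_2,\theta_1)|$ and $|\log q_{\theta_1}(x)-\log q_{\theta_2}(x)|\le\sum_kM^{(2)}_k(x)|f^{(2)}_k(\theta_2,\theta_1)|$; 2. for $t\in\{1,2\}$ and each $k$ there is $C^{(t)}_k$ with $\int|f^{(t)}_k(\theta,\theta_0)|^{2+\delta}\rho_n(d\theta)<C^{(t)}_k/n$ for all $n\ge1$; 3. there is $B$ with $\int\!\!\int M^{(1)}_k(x_1,x_0)^{2+\delta}p_\theta(x_1|x_0)\,dx_1\,q^{(0)}(dx_0)<B$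 for all $k$ and all $\theta\in\Theta$; 4. the chain under $\theta_0$ is $V$-geometrically ergodic: it is positive Harris recurrent, and there is $r>1$ with $\sum_{n\ge1}r^n\,\|P_{\theta_0}(X_n\in\cdot\mid X_0=x)-q_{\theta_0}\|_V<\infty$ for every $x$, where $\|v\|_V=\sup_{|g|<V}|\int g\,dv|$; 5. $\int M^{(1)}_k(y,x)^{2+\delta}p_{\theta_0}(y|x)\,dy<V(x)$ for all $k,x$, and $E_{q^{(0)}}[V(X_0)]<\infty$. Moreover, there is $C>0$ with $\mathcal K(\rho_n,\pi)\le C\sqrt n$ for all $n\ge1$. (B) There are $\varepsilon_n>0$ with $\varepsilon_n=O\big(\max(n^{-1/2},n^{\delta/2-1})\big)$ such that for all $n\ge1$, with expectations and variances under $P^{(n)}_{\theta_0}$: $r_n(\theta,\theta_0)$ is square integrable for every $\theta\in\Theta$; $\int\mathcal K(P^{(n)}_{\theta_0},P^{(n)}_\theta)\rho_n(d\theta)=\int E[r_n(\theta,\theta_0)]\rho_n(d\theta)\le n\varepsilon_n$; $\int\mathrm{Var}(r_n(\theta,\theta_0))\rho_n(d\theta)\le n\varepsilon_n$; and $\mathcal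 K(\rho_n,\pi)\le n\varepsilon_n$. -/

import Mathlib

open MeasureTheory ProbabilityTheory Filter Asymptotics
open scoped ENNReal NNReal Topology

namespace MarkovVB

noncomputable section

/-! ### General state space Markov chains -/

/-- The law on path space of the time-homogeneous Markov chain with one-step transition
kernel `κ` and initial law `ν`. -/
def chainLaw {S : Type*} [MeasurableSpace S] (κ : Kernel S S) [IsMarkovKernel κ]
    (ν : Measure S) : Measure (ℕ → S) :=
  Kernel.trajMeasure (X := fun _ : ℕ => S) ν
    (fun n => κ.comap
      (fun h : (i : Finset.Iic n) → S => h ⟨n, Finset.mem_Iic.2 le_rfl⟩)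
      (measurable_pi_apply _))

/-- `φ` is an irreducibility measure: it is non-trivial, and every set which it charges is reached
with positive probability, at some time `n ≥ 1`, from every starting point. -/
def IsIrreducibilityMeasure {S : Type*} [MeasurableSpace S] (κ : Kernel S S)
    (φ : Measure S) : Prop :=
  φ ≠ 0 ∧ ∀ A : Set S, MeasurableSet A → 0 < φ A → ∀ x : S, ∃ n : ℕ, 1 ≤ n ∧ 0 < (κ ^ n) x A

/-- The chain is `ψ`-irreducible, where `ψ` is a maximal irreducibility measure. -/
def IsMaximalIrreducibilityMeasure {S : Type*} [MeasurableSpace S] (κ : Kernel S S)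
    (ψ : Measure S) : Prop :=
  IsIrreducibilityMeasure κ ψ ∧ ∀ φ : Measure S, IsIrreducibilityMeasure κ φ → φ ≪ ψ

/-- The sets `D i` (with cyclic index) form a `d`-cycle, up to a `ψ`-null set. -/
def IsCycle {S : Type*} [MeasurableSpace S] (κ : Kernel S S) (ψ : Measure S) (d : ℕ)
    (D : ZMod d → Set S) : Prop :=
  (∀ i, MeasurableSet (D i)) ∧ (∀ i j, i ≠ j → Disjoint (D i) (D j)) ∧
    (∀ i, ∀ x ∈ D i, κ x (D (i + 1)) = 1) ∧ ψ (⋃ i, D i)ᶜ = 0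

/-- A `ψ`-irreducible chain is aperiodic when the largest `d` for which there is a `d`-cycle
is `1`. -/
def IsAperiodic {S : Type*} [MeasurableSpace S] (κ : Kernel S S) : Prop :=
  ∃ ψ : Measure S, IsMaximalIrreducibilityMeasure κ ψ ∧
    ∀ d : ℕ, 2 ≤ d → ¬ ∃ D : ZMod d → Set S, IsCycle κ ψ d D

/-- Harris recurrence: the chain is `ψ`-irreducible and from every starting point it visits every
set of positive `ψ`-measure infinitely often, almost surely. -/
def IsHarrisRecurrent {S : Type*} [MeasurableSpace S] (κ : Kernel S S) [IsMarkovKernel κ] :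
    Prop :=
  ∃ ψ : Measure S, IsMaximalIrreducibilityMeasure κ ψ ∧
    ∀ A : Set S, MeasurableSet A → 0 < ψ A → ∀ x : S,
      ∀ᵐ ω ∂(chainLaw κ (Measure.dirac x)), ∃ᶠ n in atTop, ω n ∈ A

/-- Positive Harris: Harris recurrent with an invariant probability measure. -/
def IsPositiveHarris {S : Type*} [MeasurableSpace S] (κ : Kernel S S) [IsMarkovKernel κ] :
    Prop :=
  IsHarrisRecurrent κ ∧ ∃ μ : Measure S, IsProbabilityMeasure μ ∧ Kernel.Invariant κ μ

open Classical in
/-- The `f`-norm `‖μ - ν‖_f = sup_{|g| < f} |∫ g dμ - ∫ g dν|` of the difference of two measures;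
it is infinite if one of the integrals does not exist. -/
def fDist {S : Type*} [MeasurableSpace S] (f : S → ℝ) (μ ν : Measure S) : ℝ≥0∞ :=
  ⨆ g : S → ℝ, ⨆ _ : Measurable g, ⨆ _ : ∀ x, |g x| < f x,
    if Integrable g μ ∧ Integrable g ν then
      ENNReal.ofReal |(∫ x, g x ∂μ) - ∫ x, g x ∂ν|
    else ⊤

/-- `V`-geometric ergodicity with invariant law `μ`: the chain is positive Harris, and there is
`r > 1` with `∑_{n ≥ 1} r ^ n ‖κ ^ n (x, ·) - μ‖_V < ∞` for every state `x`. -/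
def IsVGeometricallyErgodic {S : Type*} [MeasurableSpace S] (κ : Kernel S S)
    [IsMarkovKernel κ] (μ : Measure S) (V : S → ℝ) : Prop :=
  IsPositiveHarris κ ∧ IsProbabilityMeasure μ ∧ Kernel.Invariant κ μ ∧
    ∃ r : ℝ, 1 < r ∧ ∀ x : S,
      ∑' n : ℕ, ENNReal.ofReal (r ^ (n + 1)) * fDist V ((κ ^ (n + 1)) x) μ < ⊤

/-! ### Parametrized Markov models -/

/-- The data of a parametrized family of Markov chains on `S` with parameter space
`paramSet ⊆ E` and with a known initial density, common to all parameters.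
`transDensity θ x y` is `p_θ(y | x)`, and `invDensity θ` is `q_θ`. -/
structure Model (S E : Type*) [MeasurableSpace S] where
  paramSet : Set E
  kernel : E → Kernel S S
  isMarkov : ∀ θ, IsMarkovKernel (kernel θ)
  ref : Measure S
  transDensity : E → S → S → ℝ
  invDensity : E → S → ℝ
  initRef : Measure S
  initDensity : S → ℝ

namespace Model

variable {S E : Type*} [MeasurableSpace S]

instance (M : Model S E) (θ : E) : IsMarkovKernel (M.kernel θ) := M.isMarkov θ

/-- The initial law `q⁽⁰⁾`. -/
def initLaw (M : Model S E) : Measure S :=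
  M.initRef.withDensity (fun x => ENNReal.ofReal (M.initDensity x))

/-- The law with density `q_θ`. -/
def invLaw (M : Model S E) (θ : E) : Measure S :=
  M.ref.withDensity (fun x => ENNReal.ofReal (M.invDensity θ x))

/-- The functions in the model are what they are called: `p_θ(· | x)` is the density of the
transition kernel, `q_θ` is the density of an invariant probability measure under `θ`, and the
initial density is a probability density. -/
structure IsConsistent (M : Model S E) : Prop where
  init_nonneg : ∀ x, 0 ≤ M.initDensity x
  init_measurable : Measurable M.initDensity
  init_prob : IsProbabilityMeasure M.initLaw
  trans_nonneg : ∀ θ ∈ M.paramSet, ∀ x y, 0 ≤ M.transDensity θ x y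
  trans_measurable : ∀ θ ∈ M.paramSet, Measurable (Function.uncurry (M.transDensity θ))
  kernel_eq : ∀ θ ∈ M.paramSet, ∀ x,
    M.kernel θ x = M.ref.withDensity (fun y => ENNReal.ofReal (M.transDensity θ x y))
  inv_nonneg : ∀ θ ∈ M.paramSet, ∀ x, 0 ≤ M.invDensity θ x
  inv_measurable : ∀ θ ∈ M.paramSet, Measurable (M.invDensity θ)
  inv_prob : ∀ θ ∈ M.paramSet, IsProbabilityMeasure (M.invLaw θ)
  inv_invariant : ∀ θ ∈ M.paramSet, Kernel.Invariant (M.kernel θ) (M.invLaw θ)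

/-- `P_θ⁽ⁿ⁾`, the law of `(X_0, …, X_n)` under `θ`. -/
def pathLaw (M : Model S E) (θ : E) (n : ℕ) : Measure (Fin (n + 1) → S) :=
  (chainLaw (M.kernel θ) M.initLaw).map (fun ω (i : Fin (n + 1)) => ω i)

/-- `p_θ⁽ⁿ⁾(x_0, …, x_n) = q⁽⁰⁾(x_0) ∏_{i < n} p_θ(x_{i+1} | x_i)`. -/
def pathDensity (M : Model S E) (θ : E) (n : ℕ) (x : Fin (n + 1) → S) : ℝ :=
  M.initDensity (x 0) * ∏ i : Fin n, M.transDensity θ (x i.castSucc) (x i.succ)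

/-- The log-likelihood ratio `r_n(θ, θ₀) = log (p_{θ₀}⁽ⁿ⁾ / p_θ⁽ⁿ⁾)`. -/
def logRatio (M : Model S E) (n : ℕ) (θ θ₀ : E) (x : Fin (n + 1) → S) : ℝ :=
  Real.log (M.pathDensity θ₀ n x / M.pathDensity θ n x)

/-- The generalized Lipschitz assumption, with `m` functions `M⁽¹⁾_k`, `M⁽²⁾_k`, `f⁽¹⁾_k`,
`f⁽²⁾_k`, exponent `δ`, true parameter `θ₀` and measures `ρ_n`. -/
structure GenLipschitz [MeasurableSpace E] (M : Model S E) (θ₀ : E) (δ : ℝ)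
    (ρ : ℕ → Measure E) (m : ℕ) (M₁ : Fin m → S → S → ℝ) (M₂ : Fin m → S → ℝ)
    (f₁ f₂ : Fin m → E → E → ℝ) : Prop where
  pos₁ : ∀ k y x, 0 < M₁ k y x
  pos₂ : ∀ k x, 0 < M₂ k x
  measurable₁ : ∀ k, Measurable (Function.uncurry (M₁ k))
  measurable₂ : ∀ k, Measurable (M₂ k)
  lip_trans : ∀ θ₁ ∈ M.paramSet, ∀ θ₂ ∈ M.paramSet, ∀ x₀ x₁ : S,
    |Real.log (M.transDensity θ₁ x₀ x₁) - Real.log (M.transDensity θ₂ x₀ x₁)| ≤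
      ∑ k, M₁ k x₁ x₀ * |f₁ k θ₂ θ₁|
  lip_inv : ∀ θ₁ ∈ M.paramSet, ∀ θ₂ ∈ M.paramSet, ∀ x : S,
    |Real.log (M.invDensity θ₁ x) - Real.log (M.invDensity θ₂ x)| ≤
      ∑ k, M₂ k x * |f₂ k θ₂ θ₁|
  moment_f₁ : ∀ k, ∃ C : ℝ, ∀ n : ℕ, 1 ≤ n →
    Integrable (fun θ => |f₁ k θ θ₀| ^ (2 + δ)) (ρ n) ∧
      ∫ θ, |f₁ k θ θ₀| ^ (2 + δ) ∂(ρ n) < C / n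
  moment_f₂ : ∀ k, ∃ C : ℝ, ∀ n : ℕ, 1 ≤ n →
    Integrable (fun θ => |f₂ k θ θ₀| ^ (2 + δ)) (ρ n) ∧
      ∫ θ, |f₂ k θ θ₀| ^ (2 + δ) ∂(ρ n) < C / n
  moment_M₁ : ∃ B : ℝ, ∀ k, ∀ θ ∈ M.paramSet,
    ∫⁻ x₀, ∫⁻ x₁, ENNReal.ofReal (M₁ k x₁ x₀ ^ (2 + δ)) ∂(M.kernel θ x₀) ∂M.initLaw
      < ENNReal.ofReal B

/-- The hypotheses of the concentration theorem for non-stationary, `V`-geometrically ergodic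
chains, for the data `X` on `(Ω, P)`, the prior `π`, the exponent `δ` and the measures `ρ_n`. -/
structure NonstationaryConditions [MeasurableSpace E] {Ω : Type*} [MeasurableSpace Ω]
    (M : Model S E) (P : Measure Ω) (X : ℕ → Ω → S) (θ₀ : E) (δ : ℝ) (π : Measure E)
    (ρ : ℕ → Measure E) : Prop where
  consistent : M.IsConsistent
  mem_paramSet : θ₀ ∈ M.paramSet
  generated : HasLaw (fun ω n => X n ω) (chainLaw (M.kernel θ₀) M.initLaw) P
  aperiodic : IsAperiodic (M.kernel θ₀)
  lipschitz_ergodic : ∃ (m : ℕ) (M₁ : Fin m → S → S → ℝ) (M₂ : Fin m → S → ℝ)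
      (f₁ f₂ : Fin m → E → E → ℝ) (V : S → ℝ),
    M.GenLipschitz θ₀ δ ρ m M₁ M₂ f₁ f₂ ∧
    Measurable V ∧ (∀ x, 1 ≤ V x) ∧
    IsVGeometricallyErgodic (M.kernel θ₀) (M.invLaw θ₀) V ∧
    (∀ k x, ∫⁻ y, ENNReal.ofReal (M₁ k y x ^ (2 + δ)) ∂(M.kernel θ₀ x)
      < ENNReal.ofReal (V x)) ∧
    ∫⁻ x, ENNReal.ofReal (V x) ∂M.initLaw < ⊤
  kl_prior : ∃ C : ℝ, 0 < C ∧ ∀ n : ℕ, 1 ≤ n →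
    InformationTheory.klDiv (ρ n) π ≤ ENNReal.ofReal (C * √n)

/-- The three conditions of the PAC-Bayes bound at sample size `n`, with rate `ε` and
distribution `ρ`. Expectations and variances are under `P_{θ₀}⁽ⁿ⁾`. -/
structure PACBayesConditions [MeasurableSpace E] (M : Model S E) (θ₀ : E) (π : Measure E)
    (n : ℕ) (ρ : Measure E) (ε : ℝ) : Prop where
  memLp : ∀ θ ∈ M.paramSet, MemLp (M.logRatio n θ θ₀) 2 (M.pathLaw θ₀ n)
  integrable_mean :
    Integrable (fun θ => ∫ x, M.logRatio n θ θ₀ x ∂(M.pathLaw θ₀ n)) ρ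
  kl_eq : ∫⁻ θ, InformationTheory.klDiv (M.pathLaw θ₀ n) (M.pathLaw θ n) ∂ρ =
    ENNReal.ofReal (∫ θ, ∫ x, M.logRatio n θ θ₀ x ∂(M.pathLaw θ₀ n) ∂ρ)
  mean_le : ∫ θ, ∫ x, M.logRatio n θ θ₀ x ∂(M.pathLaw θ₀ n) ∂ρ ≤ n * ε
  integrable_var :
    Integrable (fun θ => variance (M.logRatio n θ θ₀) (M.pathLaw θ₀ n)) ρ
  var_le : ∫ θ, variance (M.logRatio n θ θ₀) (M.pathLaw θ₀ n) ∂ρ ≤ n * ε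
  kl_prior_le : InformationTheory.klDiv ρ π ≤ ENNReal.ofReal (n * ε)

end Model

/-! ### The simple linear model -/

/-- The transition kernel `x ↦ N(θ x, 1)` of `X_n = θ X_{n-1} + W_n`. -/
def ar1Kernel (θ : ℝ) : Kernel ℝ ℝ where
  toFun x := gaussianReal (θ * x) 1
  measurable' := by
    have h : Measurable (fun x : ℝ => (θ * x, (1 : ℝ≥0))) := by fun_prop
    exact measurable_gaussianReal.comp h

lemma isMarkovKernel_ar1Kernel (θ : ℝ) : IsMarkovKernel (ar1Kernel θ) :=
  ⟨fun x => inferInstanceAs (IsProbabilityMeasure (gaussianReal (θ * x) 1))⟩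

/-- The simple linear model `X_n = θ X_{n-1} + W_n` with standard Gaussian noise and parameter
space `(-1, 1)`; the invariant law under `θ` is `N(0, 1 / (1 - θ ^ 2))`. -/
def simpleLinearModel (initRef : Measure ℝ) (initDensity : ℝ → ℝ) : Model ℝ ℝ where
  paramSet := Set.Ioo (-1) 1
  kernel := ar1Kernel
  isMarkov := isMarkovKernel_ar1Kernel
  ref := volume
  transDensity θ x y := gaussianPDFReal (θ * x) 1 y
  invDensity θ x := gaussianPDFReal 0 (Real.toNNReal (1 / (1 - θ ^ 2))) x
  initRef := initRef
  initDensity := initDensity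

/-- The Beta distributions rescaled to `(-1, 1)`: the laws of `2 Y - 1` with
`Y ∼ Beta(a, b)`, `a, b > 0`. -/
def scaledBetaFamily : Set (Measure ℝ) :=
  {ρ | ∃ a b : ℝ, 0 < a ∧ 0 < b ∧ ρ = (betaMeasure a b).map (fun y => 2 * y - 1)}

/-- The uniform distribution on `(-1, 1)`. -/
def uniformPrior : Measure ℝ := ProbabilityTheory.cond volume (Set.Ioo (-1 : ℝ) 1)

end

end MarkovVB

open MarkovVB

/-!
Given its initial state, the chain is Gaussian with mean `θ₀ ^ n * x` and a variance converging
geometrically to the invariant one, which yields geometric ergodicity in the norm weighted by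
`V x = c * (1 + |x| ^ p)`. The log-densities of the transitions are Lipschitz in the parameter, with
an envelope quadratic in the states, so along a path of length `n` the log-ratio is at most
`|θ - θ₀|` times a random factor whose second moment grows like `n ^ 2`.

The approximating Beta distribution has mode `θ₀` and concentration `n ^ 4`. This is a compromise:
the squared deviation from `θ₀`, even weighted by the factor `1 / (1 - θ ^ 2)` that the Gaussian
invariant laws bring in, has mean of order `n ^ (-4)`, which leaves bounded means and variances of
the log-ratio, while the divergence from the uniform distribution grows only logarithmically and is
absorbed by `√n`.
-/

namespace MarkovVB

section PathSpace

variable {S : Type*} [MeasurableSpace S]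

/-- The first `n + 1` states of a path. -/
def initialSegment (n : ℕ) (ω : ℕ → S) : Fin (n + 1) → S := fun i => ω i

@[fun_prop]
lemma measurable_initialSegment (n : ℕ) : Measurable (initialSegment (S := S) n) :=
  measurable_pi_lambda _ fun _ => measurable_pi_apply _

lemma initialSegment_last {S : Type*} (n : ℕ) (ω : ℕ → S) :
    initialSegment n ω (Fin.last n) = ω n := by
  simp [initialSegment]

lemma initialSegment_zero {S : Type*} (ω : ℕ → S) : initialSegment 0 ω = fun _ => ω 0 := by
  ext i
  simp [initialSegment]

lemma initialSegment_succ {S : Type*} (n : ℕ) (ω : ℕ → S) :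
    initialSegment (n + 1) ω = Fin.snoc (α := fun _ => S) (initialSegment n ω) (ω (n + 1)) := by
  ext i
  refine Fin.lastCases ?_ (fun i => ?_) i <;> simp [initialSegment]

@[fun_prop]
lemma measurable_finSnoc (n : ℕ) :
    Measurable fun p : (Fin n → S) × S => Fin.snoc (α := fun _ => S) p.1 p.2 := by
  refine measurable_pi_lambda _ fun i => Fin.lastCases ?_ (fun i => ?_) i
  · simpa using measurable_snd
  · simp only [Fin.snoc_castSucc]
    fun_prop

lemma measurable_lintegral_finSnoc (κ : Kernel S S) [IsSFiniteKernel κ] (n : ℕ)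
    {f : (Fin (n + 2) → S) → ℝ≥0∞} (hf : Measurable f) :
    Measurable fun x : Fin (n + 1) → S =>
      ∫⁻ y, f (Fin.snoc (α := fun _ => S) x y) ∂κ (x (Fin.last n)) :=
  (hf.comp (measurable_finSnoc (n + 1))).lintegral_kernel_prod_right'
    (κ := κ.comap (fun x : Fin (n + 1) → S => x (Fin.last n)) (by fun_prop))

lemma piLE_eq_comap_initialSegment (n : ℕ) :
    Filtration.piLE (X := fun _ : ℕ => S) n =
      MeasurableSpace.comap (initialSegment n) inferInstance := by
  rw [Filtration.piLE_eq_comap_frestrictLe]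
  let e (x : Fin (n + 1) → S) (i : Finset.Iic n) : S :=
    x ⟨i, Nat.lt_succ_of_le (Finset.mem_Iic.1 i.2)⟩
  let e' (h : Finset.Iic n → S) (i : Fin (n + 1)) : S :=
    h ⟨i, Finset.mem_Iic.2 (Nat.le_of_lt_succ i.2)⟩
  have he : Measurable e := measurable_pi_lambda _ fun _ => measurable_pi_apply _
  have he' : Measurable e' := measurable_pi_lambda _ fun _ => measurable_pi_apply _
  apply le_antisymm
  · rw [show Preorder.frestrictLe (π := fun _ : ℕ => S) n = e ∘ initialSegment n from rfl,
      ← MeasurableSpace.comap_comp]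
    exact MeasurableSpace.comap_mono he.comap_le
  · rw [show initialSegment n = e' ∘ Preorder.frestrictLe (π := fun _ : ℕ => S) n from rfl,
      ← MeasurableSpace.comap_comp]
    exact MeasurableSpace.comap_mono he'.comap_le

lemma ext_of_map_initialSegment {μ μ' : Measure (ℕ → S)} [IsFiniteMeasure μ]
    (h : ∀ n, μ.map (initialSegment n) = μ'.map (initialSegment n)) : μ = μ' := by
  refine IsProjectiveLimit.unique (P := fun I => μ.map I.restrict) (fun I => rfl) fun I => ?_
  let n := I.sup id
  let restrictTo (x : Fin (n + 1) → S) (i : I) : S :=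
    x ⟨i, Nat.lt_succ_of_le (Finset.le_sup (f := id) i.2)⟩
  have hr : Measurable restrictTo := measurable_pi_lambda _ fun _ => measurable_pi_apply _
  change _ = μ.map (restrictTo ∘ initialSegment n)
  rw [← Measure.map_map hr (by fun_prop), h n, Measure.map_map hr (by fun_prop)]
  rfl

/-- The product of `g` over the transitions of a finite path: the density of its law when the
transition kernel has density `g`. -/
noncomputable def transitionProd (g : S → S → ℝ≥0∞) (n : ℕ) (x : Fin (n + 1) → S) : ℝ≥0∞ :=
  ∏ i : Fin n, g (x i.castSucc) (x i.succ)

lemma measurable_transitionProd {g : S → S → ℝ≥0∞} (hg : Measurable (Function.uncurry g))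
    (n : ℕ) : Measurable (transitionProd g n) :=
  Finset.measurable_fun_prod _ fun i _ =>
    hg.comp (by fun_prop : Measurable fun x : Fin (n + 1) → S => (x i.castSucc, x i.succ))

lemma transitionProd_zero {S : Type*} (g : S → S → ℝ≥0∞) : transitionProd g 0 = 1 := by
  ext
  simp [transitionProd]

lemma transitionProd_snoc {S : Type*} (g : S → S → ℝ≥0∞) (n : ℕ) (x : Fin (n + 1) → S) (y : S) :
    transitionProd g (n + 1) (Fin.snoc (α := fun _ => S) x y) =
      transitionProd g n x * g (x (Fin.last n)) y := by
  simp [transitionProd, Fin.prod_univ_castSucc, ← Fin.castSucc_succ]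

end PathSpace

section MarkovProperty

variable {S : Type*} [MeasurableSpace S]

/-- Under the law `μ` on path space, the coordinates form a Markov chain with transition kernel
`κ`: given the states up to time `n`, the state at time `n + 1` has law `κ (ω n)`. The property is
tested on nonnegative functions of the first `n + 2` states; nothing is said about the initial
law. -/
def IsMarkovChain (κ : Kernel S S) (μ : Measure (ℕ → S)) : Prop :=
  ∀ (n : ℕ) (f : (Fin (n + 2) → S) → ℝ≥0∞), Measurable f →
    ∫⁻ ω, f (initialSegment (n + 1) ω) ∂μ =
      ∫⁻ ω, ∫⁻ y, f (Fin.snoc (α := fun _ => S) (initialSegment n ω) y) ∂κ (ω n) ∂μ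

instance isProbabilityMeasure_chainLaw (κ : Kernel S S) [IsMarkovKernel κ] (ν : Measure S)
    [IsProbabilityMeasure ν] : IsProbabilityMeasure (chainLaw κ ν) := by
  unfold chainLaw; infer_instance

lemma isMarkovChain_chainLaw (κ : Kernel S S) [IsMarkovKernel κ] (ν : Measure S)
    [IsProbabilityMeasure ν] : IsMarkovChain κ (chainLaw κ ν) := by
  intro n f hf
  let toFin (h : Finset.Iic n → S) (i : Fin (n + 1)) : S :=
    h ⟨i, Finset.mem_Iic.2 (Nat.le_of_lt_succ i.2)⟩
  have htoFin : Measurable toFin := measurable_pi_lambda _ fun _ => measurable_pi_apply _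
  let g (p : (Finset.Iic n → S) × S) : ℝ≥0∞ := f (Fin.snoc (α := fun _ => S) (toFin p.1) p.2)
  have hg : Measurable g := hf.comp <| (measurable_finSnoc (n + 1)).comp <|
    (htoFin.comp measurable_fst).prodMk measurable_snd
  have h := Kernel.map_frestrictLe_trajMeasure_compProd_eq_map_trajMeasure
    (X := fun _ : ℕ => S) (μ₀ := ν) (κ := fun n => κ.comap
      (fun h : (i : Finset.Iic n) → S => h ⟨n, Finset.mem_Iic.2 le_rfl⟩)
      (measurable_pi_apply _)) (a := n)
  have hint := congrArg (fun m => ∫⁻ p, g p ∂m) h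
  rw [Measure.lintegral_compProd hg, lintegral_map hg (by fun_prop),
    lintegral_map hg.lintegral_kernel_prod_right' (by fun_prop)] at hint
  simp_rw [initialSegment_succ]
  exact hint.symm

lemma map_zero_chainLaw (κ : Kernel S S) [IsMarkovKernel κ] (ν : Measure S) :
    (chainLaw κ ν).map (fun ω => ω 0) = ν := by
  change (chainLaw κ ν).map ((fun h : (i : Finset.Iic 0) → S => h ⟨0, by simp⟩) ∘
    Preorder.frestrictLe 0) = ν
  rw [← Measure.map_map (by fun_prop) (by fun_prop), chainLaw, Kernel.trajMeasure,
    Measure.map_comp _ _ (by fun_prop), Kernel.traj_map_frestrictLe, Kernel.partialTraj_self,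
    Measure.id_comp, Measure.map_map (by fun_prop) (by fun_prop)]
  exact Measure.map_id

namespace IsMarkovChain

variable {κ κ' : Kernel S S} {μ μ' : Measure (ℕ → S)}

lemma map_apply_succ (hμ : IsMarkovChain κ μ) (n : ℕ) :
    μ.map (fun ω => ω (n + 1)) = (μ.map fun ω => ω n).bind κ := by
  refine Measure.ext_of_lintegral _ fun f hf => ?_
  rw [lintegral_map hf (by fun_prop), Measure.lintegral_bind (by fun_prop) hf.aemeasurable,
    lintegral_map hf.lintegral_kernel (by fun_prop)]
  simpa [initialSegment_last] using
    hμ n (fun x => f (x (Fin.last (n + 1)))) (hf.comp (measurable_pi_apply _))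

lemma map_apply (hμ : IsMarkovChain κ μ) (n : ℕ) :
    μ.map (fun ω => ω n) = (μ.map fun ω => ω 0).bind (κ ^ n : Kernel S S) := by
  induction n with
  | zero =>
    rw [pow_zero]
    exact Measure.id_comp.symm
  | succ n ih =>
    rw [hμ.map_apply_succ, ih, Measure.comp_assoc, pow_succ']
    rfl

lemma setLIntegral_kernel_apply (hμ : IsMarkovChain κ μ) (n : ℕ) {T : Set (Fin (n + 1) → S)}
    (hT : MeasurableSet T) {A : Set S} (hA : MeasurableSet A) :
    ∫⁻ ω in initialSegment n ⁻¹' T, κ (ω n) A ∂μ =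
      μ ((fun ω => ω (n + 1)) ⁻¹' A ∩ initialSegment n ⁻¹' T) := by
  let f (x : Fin (n + 2) → S) : ℝ≥0∞ := T.indicator 1 (Fin.init x) * A.indicator 1 (x (Fin.last _))
  have hinit : Measurable fun x : Fin (n + 2) → S => (Fin.init x : Fin (n + 1) → S) :=
    measurable_pi_lambda _ fun i => measurable_pi_apply i.castSucc
  have hf : Measurable f := ((measurable_one.indicator hT).comp hinit).mul
    ((measurable_one.indicator hA).comp (measurable_pi_apply _))
  have hT' := measurable_initialSegment n hT
  calc ∫⁻ ω in initialSegment n ⁻¹' T, κ (ω n) A ∂μ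
      = ∫⁻ ω, ∫⁻ y, f (Fin.snoc (α := fun _ => S) (initialSegment n ω) y) ∂κ (ω n) ∂μ := by
        rw [← lintegral_indicator hT']
        refine lintegral_congr fun ω => ?_
        by_cases hω : initialSegment n ω ∈ T <;> simp [f, hω, lintegral_indicator_one hA]
    _ = ∫⁻ ω, f (initialSegment (n + 1) ω) ∂μ := (hμ n f hf).symm
    _ = μ ((fun ω => ω (n + 1)) ⁻¹' A ∩ initialSegment n ⁻¹' T) := by
        rw [← lintegral_indicator_one ((measurable_pi_apply _ hA).inter hT')]
        refine lintegral_congr fun ω => ?_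
        rw [Set.inter_indicator_one, mul_comm, initialSegment_succ]
        simp [f]
        rfl

lemma condExp_indicator [IsFiniteMeasure μ] [IsFiniteKernel κ] (hμ : IsMarkovChain κ μ) (n : ℕ)
    {A : Set S} (hA : MeasurableSet A) :
    μ[((fun ω : ℕ → S => ω (n + 1)) ⁻¹' A).indicator (1 : (ℕ → S) → ℝ) |
      Filtration.piLE (X := fun _ => S) n] =ᵐ[μ] fun ω => (κ (ω n)).real A := by
  have hA' : MeasurableSet ((fun ω : ℕ → S => ω (n + 1)) ⁻¹' A) := measurable_pi_apply _ hA
  have hκA : Measurable fun x => (κ x).real A := (κ.measurable_coe hA).ennreal_toReal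
  have hκA_int : Integrable (fun ω : ℕ → S => (κ (ω n)).real A) μ := by
    refine Integrable.of_bound (hκA.comp (measurable_pi_apply n)).aestronglyMeasurable
      κ.bound.toReal (ae_of_all _ fun ω => ?_)
    rw [Real.norm_of_nonneg measureReal_nonneg]
    exact ENNReal.toReal_mono κ.bound_ne_top (Kernel.measure_le_bound _ _ _)
  refine (ae_eq_condExp_of_forall_setIntegral_eq (Filtration.piLE.le n)
    ((integrable_const 1).indicator hA') (fun s _ _ => hκA_int.integrableOn) ?_ ?_).symm
  · rw [piLE_eq_comap_initialSegment]
    rintro _ ⟨T, hT, rfl⟩ -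
    rw [integral_indicator_one hA', measureReal_restrict_apply hA', Measure.real,
      ← hμ.setLIntegral_kernel_apply n hT hA]
    exact integral_toReal ((κ.measurable_coe hA).comp (measurable_pi_apply n)).aemeasurable
      (ae_of_all _ fun _ => measure_lt_top _ _)
  · rw [piLE_eq_comap_initialSegment]
    have hlast : Measurable fun x : Fin (n + 1) → S => (κ (x (Fin.last n))).real A :=
      hκA.comp (measurable_pi_apply _)
    exact (hlast.comp (comap_measurable (initialSegment n))).aestronglyMeasurable

lemma map_initialSegment_eq_withDensity [IsSFiniteKernel κ]
    (hμ : IsMarkovChain κ μ) (hμ' : IsMarkovChain κ' μ')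
    (h_zero : μ.map (fun ω => ω 0) = μ'.map fun ω => ω 0) {g : S → S → ℝ≥0∞}
    (hg : Measurable (Function.uncurry g)) (hκ : ∀ x, κ x = (κ' x).withDensity (g x)) (n : ℕ) :
    μ.map (initialSegment n) = (μ'.map (initialSegment n)).withDensity (transitionProd g n) := by
  have hprod := measurable_transitionProd hg
  induction n with
  | zero =>
    let constPath (x : S) (_ : Fin 1) : S := x
    have hconst : Measurable constPath := measurable_pi_lambda _ fun _ => measurable_id
    have hseg : initialSegment (S := S) 0 = constPath ∘ fun ω => ω 0 :=
      funext initialSegment_zero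
    rw [hseg, ← Measure.map_map hconst (by fun_prop), h_zero,
      Measure.map_map hconst (by fun_prop), transitionProd_zero, withDensity_one]
  | succ n ih =>
    refine Measure.ext_of_lintegral _ fun f hf => ?_
    have hstep := measurable_lintegral_finSnoc κ n hf
    rw [lintegral_withDensity_eq_lintegral_mul _ (hprod _) hf, lintegral_map hf (by fun_prop),
      lintegral_map ((hprod _).mul hf) (by fun_prop), hμ n f hf, hμ' n _ ((hprod _).mul hf)]
    calc ∫⁻ ω, ∫⁻ y, f (Fin.snoc (α := fun _ => S) (initialSegment n ω) y) ∂κ (ω n) ∂μ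
        = ∫⁻ x, ∫⁻ y, f (Fin.snoc (α := fun _ => S) x y) ∂κ (x (Fin.last n))
            ∂μ.map (initialSegment n) := by
          rw [lintegral_map hstep (by fun_prop)]
          simp only [initialSegment_last]
      _ = ∫⁻ ω, transitionProd g n (initialSegment n ω) *
            ∫⁻ y, f (Fin.snoc (α := fun _ => S) (initialSegment n ω) y) ∂κ (ω n) ∂μ' := by
          rw [ih, lintegral_withDensity_eq_lintegral_mul _ (hprod n) hstep,
            lintegral_map ((hprod n).mul hstep) (by fun_prop)]
          simp only [Pi.mul_apply, initialSegment_last]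
      _ = _ := by
          refine lintegral_congr fun ω => ?_
          have hgω : Measurable (g (ω n)) := hg.comp (measurable_const.prodMk measurable_id)
          have hfω : Measurable fun y => f (Fin.snoc (α := fun _ => S) (initialSegment n ω) y) :=
            (hf.comp (measurable_finSnoc (n + 1))).comp (measurable_const.prodMk measurable_id)
          rw [hκ, lintegral_withDensity_eq_lintegral_mul _ hgω hfω,
            ← lintegral_const_mul _ (hgω.mul hfω)]
          simp only [Pi.mul_apply, transitionProd_snoc, initialSegment_last, mul_assoc]

lemma ext [IsFiniteMeasure μ] [IsSFiniteKernel κ] (hμ : IsMarkovChain κ μ)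
    (hμ' : IsMarkovChain κ μ') (h_zero : μ.map (fun ω => ω 0) = μ'.map fun ω => ω 0) :
    μ = μ' := by
  refine ext_of_map_initialSegment fun n => ?_
  rw [hμ.map_initialSegment_eq_withDensity hμ' h_zero (g := fun _ _ => 1) measurable_const
    (fun x => withDensity_one.symm),
    show transitionProd (fun _ _ => 1) n = 1 by ext; simp [transitionProd], withDensity_one]

end IsMarkovChain

end MarkovProperty

section KullbackLeibler

variable {α : Type*} [MeasurableSpace α] {μ ν : Measure α}

lemma klDiv_withDensity_exp [IsProbabilityMeasure μ] [IsProbabilityMeasure ν] {ℓ : α → ℝ}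
    (hℓ : Measurable ℓ) (h : μ = ν.withDensity fun x => ENNReal.ofReal (Real.exp (ℓ x)))
    (hint : Integrable ℓ μ) :
    InformationTheory.klDiv μ ν = ENNReal.ofReal (∫ x, ℓ x ∂μ) ∧ 0 ≤ ∫ x, ℓ x ∂μ := by
  have hac : μ ≪ ν := h ▸ withDensity_absolutelyContinuous _ _
  have hrn : μ.rnDeriv ν =ᵐ[ν] fun x => ENNReal.ofReal (Real.exp (ℓ x)) := by
    rw [h]
    exact Measure.rnDeriv_withDensity _ hℓ.exp.ennreal_ofReal
  have hllr : llr μ ν =ᵐ[μ] ℓ := by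
    filter_upwards [hac.ae_le hrn] with x hx
    rw [llr, hx, ENNReal.toReal_ofReal (Real.exp_pos _).le, Real.log_exp]
  have hi : Integrable (llr μ ν) μ := hint.congr hllr.symm
  have hkl := InformationTheory.klDiv_of_ac_of_integrable hac hi
  have hnonneg := InformationTheory.integral_llr_add_sub_measure_univ_nonneg hac hi
  rw [integral_congr_ae hllr] at hkl hnonneg
  simp only [probReal_univ, add_sub_cancel_right] at hkl hnonneg
  exact ⟨hkl, hnonneg⟩

lemma toReal_rnDeriv_le_of_le_smul [SigmaFinite ν] {c : ℝ}
    (hc : 0 ≤ c) (h : μ ≤ ENNReal.ofReal c • ν) : ∀ᵐ x ∂ν, (μ.rnDeriv ν x).toReal ≤ c := by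
  have hrn : μ.rnDeriv ν ≤ᵐ[ν] fun _ => ENNReal.ofReal c := by
    refine ae_le_of_forall_setLIntegral_le_of_sigmaFinite (Measure.measurable_rnDeriv _ _)
      fun s _ _ => (Measure.setLIntegral_rnDeriv_le s).trans ?_
    rw [setLIntegral_const]
    exact h s
  filter_upwards [hrn] with x hx using ENNReal.toReal_le_of_le_ofReal hc hx

lemma klDiv_le_log_of_le_smul [IsProbabilityMeasure μ] [IsProbabilityMeasure ν] {c : ℝ}
    (h : μ ≤ ENNReal.ofReal c • ν) :
    InformationTheory.klDiv μ ν ≤ ENNReal.ofReal (Real.log c) := by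
  have hac : μ ≪ ν := (Measure.absolutelyContinuous_of_le h).trans
    Measure.smul_absolutelyContinuous
  have hc : 1 ≤ c := by simpa using h Set.univ
  let f : α → ℝ := fun x => (μ.rnDeriv ν x).toReal
  have hint : Integrable f ν := Measure.integrable_toReal_rnDeriv
  have hbound : ∀ᵐ x ∂ν, InformationTheory.klFun (f x) ≤ f x * Real.log c + (1 - f x) := by
    filter_upwards [toReal_rnDeriv_le_of_le_smul (by linarith) h] with x hx
    rw [InformationTheory.klFun]
    rcases (show 0 ≤ f x from ENNReal.toReal_nonneg).eq_or_lt with h_zero | h_pos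
    · simp [← h_zero]
    · have := mul_le_mul_of_nonneg_left (Real.log_le_log h_pos hx) h_pos.le
      linarith
  have hint' : Integrable (fun x => f x * Real.log c + (1 - f x)) ν :=
    (hint.mul_const _).add ((integrable_const _).sub hint)
  calc InformationTheory.klDiv μ ν
      ≤ ∫⁻ x, ENNReal.ofReal (f x * Real.log c + (1 - f x)) ∂ν := by
        rw [InformationTheory.klDiv_eq_lintegral_klFun_of_ac hac]
        exact lintegral_mono_ae (hbound.mono fun x hx => ENNReal.ofReal_le_ofReal hx)
    _ = ENNReal.ofReal (∫ x, f x * Real.log c + (1 - f x) ∂ν) :=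
        (ofReal_integral_eq_lintegral_ofReal hint' (hbound.mono fun x hx =>
          (InformationTheory.klFun_nonneg ENNReal.toReal_nonneg).trans hx)).symm
    _ = ENNReal.ofReal (Real.log c) := by
        have h_integral : ∫ x, f x ∂ν = 1 := by simp [f, Measure.integral_toReal_rnDeriv hac]
        rw [integral_add (hint.mul_const _) (by fun_prop), integral_mul_const,
          integral_sub (integrable_const _) hint, h_integral]
        simp

end KullbackLeibler

section GaussianMoments

lemma add_rpow_le_two_rpow_mul {a b p : ℝ} (ha : 0 ≤ a) (hb : 0 ≤ b) (hp : 0 ≤ p) :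
    (a + b) ^ p ≤ 2 ^ p * (a ^ p + b ^ p) := by
  have hmax : a + b ≤ 2 * max a b := by linarith [le_max_left a b, le_max_right a b]
  refine (Real.rpow_le_rpow (by positivity) hmax hp).trans ?_
  rw [Real.mul_rpow (by norm_num) (by positivity)]
  refine mul_le_mul_of_nonneg_left ?_ (by positivity)
  rcases max_choice a b with h | h <;> rw [h]
  · exact le_add_of_nonneg_right (by positivity)
  · exact le_add_of_nonneg_left (by positivity)

/-- The absolute moment of order `p` of the standard Gaussian distribution. -/
noncomputable def gaussianAbsMoment (p : ℝ) : ℝ := ∫ z, |z| ^ p ∂(gaussianReal 0 1)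

lemma gaussianAbsMoment_nonneg (p : ℝ) : 0 ≤ gaussianAbsMoment p :=
  integral_nonneg fun _ => by positivity

lemma integrable_abs_rpow_gaussianReal (m : ℝ) (v : ℝ≥0) {p : ℝ} (hp : 0 ≤ p) :
    Integrable (fun z => |z| ^ p) (gaussianReal m v) := by
  simpa [hp] using (memLp_id_gaussianReal (μ := m) (v := v) p.toNNReal).integrable_norm_rpow'

lemma gaussianReal_eq_map_add_sqrt_mul (m : ℝ) (v : ℝ≥0) :
    gaussianReal m v = (gaussianReal 0 1).map fun z => m + √v * z := by
  rw [show (fun z => m + √v * z) = (m + ·) ∘ (√(v : ℝ) * ·) from rfl,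
    ← Measure.map_map (by fun_prop) (by fun_prop), gaussianReal_map_const_mul,
    gaussianReal_map_const_add]
  congr 1
  · simp
  · ext; simp

lemma lintegral_abs_rpow_gaussianReal_le (m : ℝ) (v : ℝ≥0) {p : ℝ} (hp : 0 ≤ p) :
    ∫⁻ y, ENNReal.ofReal (|y| ^ p) ∂(gaussianReal m v) ≤
      ENNReal.ofReal (2 ^ p * (|m| ^ p + √v ^ p * gaussianAbsMoment p)) := by
  have hpoint (z : ℝ) : |m + √v * z| ^ p ≤ 2 ^ p * (|m| ^ p + √v ^ p * |z| ^ p) := by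
    refine (Real.rpow_le_rpow (abs_nonneg _) (abs_add_le _ _) hp).trans ?_
    refine (add_rpow_le_two_rpow_mul (abs_nonneg _) (abs_nonneg _) hp).trans_eq ?_
    rw [abs_mul, abs_of_nonneg (Real.sqrt_nonneg _), Real.mul_rpow (by positivity) (by positivity)]
  have hint := integrable_abs_rpow_gaussianReal 0 1 hp
  rw [gaussianReal_eq_map_add_sqrt_mul, lintegral_map (by fun_prop) (by fun_prop)]
  refine (lintegral_mono fun z => ENNReal.ofReal_le_ofReal (hpoint z)).trans_eq ?_
  rw [← ofReal_integral_eq_lintegral_ofReal (by fun_prop) (ae_of_all _ fun z => by positivity),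
    integral_const_mul, integral_add (integrable_const _) (hint.const_mul _), integral_const_mul]
  simp [gaussianAbsMoment]

end GaussianMoments

section Recurrence

variable {S : Type*} [MeasurableSpace S] {κ : Kernel S S} {ψ : Measure S}

lemma pow_succ_absolutelyContinuous (h : ∀ x, κ x ≪ ψ) (n : ℕ) (x : S) :
    (κ ^ (n + 1)) x ≪ ψ := by
  refine Measure.AbsolutelyContinuous.mk fun A hA hψA => ?_
  simp [Kernel.pow_succ_apply_eq_lintegral _ _ _ hA, h _ hψA]

lemma isMaximalIrreducibilityMeasure_of_equiv [IsMarkovKernel κ] [Nonempty S]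
    (h : ∀ x, κ x ≪ ψ) (h' : ∀ x, ψ ≪ κ x) : IsMaximalIrreducibilityMeasure κ ψ := by
  refine ⟨⟨?_, fun A _ hA x => ⟨1, le_rfl, ?_⟩⟩, fun φ hφ => ?_⟩
  · rintro rfl
    obtain ⟨x⟩ := ‹Nonempty S›
    exact IsProbabilityMeasure.ne_zero (κ x)
      (Measure.absolutelyContinuous_zero_iff.1 (h x))
  · rw [pow_one]
    exact pos_iff_ne_zero.2 fun h_zero => hA.ne' (h' x h_zero)
  · refine Measure.AbsolutelyContinuous.mk fun A hA hψA => ?_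
    by_contra hφA
    obtain ⟨x⟩ := ‹Nonempty S›
    obtain ⟨n, hn, hpos⟩ := hφ.2 A hA (pos_iff_ne_zero.2 hφA) x
    obtain ⟨k, rfl⟩ := Nat.exists_eq_add_of_le' hn
    exact hpos.ne' (pow_succ_absolutelyContinuous h k x hψA)

-- In a `d`-cycle every class that is entered from a nonempty class is `ψ`-conull, so two distinct
-- consecutive classes would be disjoint and both conull.
lemma not_isCycle_of_absolutelyContinuous [IsMarkovKernel κ] [NeZero ψ] (h' : ∀ x, ψ ≪ κ x)
    {d : ℕ} (hd : 2 ≤ d) (D : ZMod d → Set S) : ¬ IsCycle κ ψ d D := by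
  rintro ⟨hD_meas, hD_disj, hD_step, hD_compl⟩
  have : Fact (1 < d) := ⟨hd⟩
  have h_nonempty : ∃ i, (D i).Nonempty := by
    by_contra! h_empty
    simp only [h_empty, Set.iUnion_empty, Set.compl_empty, Measure.measure_univ_eq_zero] at hD_compl
    exact NeZero.ne ψ hD_compl
  have h_conull : ∀ i, (D i).Nonempty → ψ (D (i + 1))ᶜ = 0 := fun i ⟨x, hx⟩ =>
    h' x ((prob_compl_eq_zero_iff (hD_meas (i + 1))).2 (hD_step i x hx))
  have h_next : ∀ i, ψ (D i)ᶜ = 0 → (D i).Nonempty := by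
    intro i hi
    by_contra! h_empty
    rw [h_empty, Set.compl_empty, Measure.measure_univ_eq_zero] at hi
    exact NeZero.ne ψ hi
  obtain ⟨i, hi⟩ := h_nonempty
  have h_one := h_conull i hi
  have h_two := h_conull _ (h_next _ h_one)
  have h_disj := hD_disj (i + 1) (i + 1 + 1) (by simp)
  refine NeZero.ne ψ (Measure.measure_univ_eq_zero.1 ?_)
  rw [← Set.union_compl_self (D (i + 1))]
  exact measure_union_null (measure_mono_null h_disj.subset_compl_right h_two) h_one

lemma isAperiodic_of_equiv [IsMarkovKernel κ] [Nonempty S] (h : ∀ x, κ x ≪ ψ)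
    (h' : ∀ x, ψ ≪ κ x) : IsAperiodic κ := by
  have hmax := isMaximalIrreducibilityMeasure_of_equiv h h'
  have : NeZero ψ := ⟨hmax.1.1⟩
  exact ⟨ψ, hmax, fun d hd ⟨D, hD⟩ => not_isCycle_of_absolutelyContinuous h' hd D hD⟩

lemma IsMarkovChain.ae_frequently_mem [IsFiniteKernel κ] {μ : Measure (ℕ → S)}
    [IsFiniteMeasure μ] (hμ : IsMarkovChain κ μ) {A B : Set S} (hA : MeasurableSet A) {c : ℝ}
    (hc : 0 < c) (hB : ∀ x ∈ B, c ≤ (κ x).real A) :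
    ∀ᵐ ω ∂μ, (∃ᶠ n in atTop, ω n ∈ B) → ∃ᶠ n in atTop, ω n ∈ A := by
  have hA_adapted (n : ℕ) : MeasurableSet[Filtration.piLE (X := fun _ => S) n]
      ((fun ω : ℕ → S => ω n) ⁻¹' A) := by
    rw [piLE_eq_comap_initialSegment]
    exact ⟨(fun x => x (Fin.last n)) ⁻¹' A, measurable_pi_apply _ hA, rfl⟩
  filter_upwards [ae_mem_limsup_atTop_iff μ hA_adapted,
    ae_all_iff.2 fun n => hμ.condExp_indicator n hA] with ω h_limsup h_condExp hfreq
  rw [Nat.frequently_atTop_iff_infinite,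
    Set.infinite_iff_tendsto_sum_indicator_atTop hc] at hfreq
  refine mem_limsup_iff_frequently_mem.1 (h_limsup.2 ?_)
  simp_rw [h_condExp]
  refine tendsto_atTop_mono (fun n => Finset.sum_le_sum fun k _ => ?_) hfreq
  exact Set.indicator_apply_le' (fun hk => hB _ hk) fun _ => measureReal_nonneg

lemma ae_exists_frequently_lt_of_lintegral_le {α : Type*} [MeasurableSpace α] {μ : Measure α}
    {f : ℕ → α → ℝ≥0∞} (hf : ∀ n, Measurable (f n)) {C : ℝ≥0∞} (hC : C ≠ ⊤)
    (h : ∀ n, ∫⁻ a, f n a ∂μ ≤ C) : ∀ᵐ a ∂μ, ∃ k : ℕ, ∃ᶠ n in atTop, f n a < k := by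
  have hfatou : ∫⁻ a, liminf (fun n => f n a) atTop ∂μ ≤ C :=
    (lintegral_liminf_le hf).trans
      (liminf_le_of_frequently_le' (Frequently.of_forall h))
  filter_upwards [ae_lt_top (.liminf hf) (hfatou.trans_lt hC.lt_top).ne] with a ha
  obtain ⟨k, hk⟩ := ENNReal.exists_nat_gt ha.ne
  exact ⟨k, frequently_lt_of_liminf_lt (by isBoundedDefault) hk⟩

lemma isHarrisRecurrent_of_lintegral_pow_le [IsMarkovKernel κ]
    (hψ : IsMaximalIrreducibilityMeasure κ ψ) {W : S → ℝ≥0∞} (hW : Measurable W)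
    (h_bdd : ∀ x, ⨆ n : ℕ, ∫⁻ y, W y ∂(κ ^ n) x ≠ ⊤)
    (h_minor : ∀ k : ℕ, ∃ φ : Measure S, ψ ≪ φ ∧ ∀ x, W x < k → φ ≤ κ x) :
    IsHarrisRecurrent κ := by
  refine ⟨ψ, hψ, fun A hA hψA x => ?_⟩
  have hchain := isMarkovChain_chainLaw κ (Measure.dirac x)
  have h_moment (n : ℕ) : ∫⁻ ω, W (ω n) ∂chainLaw κ (Measure.dirac x) = ∫⁻ y, W y ∂(κ ^ n) x := by
    rw [← lintegral_map (g := fun ω : ℕ → S => ω n) hW (by fun_prop), hchain.map_apply,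
      map_zero_chainLaw, Measure.dirac_bind (Kernel.measurable _)]
  have h_return := ae_exists_frequently_lt_of_lintegral_le
    (f := fun n (ω : ℕ → S) => W (ω n)) (by fun_prop) (h_bdd x) fun n =>
      (h_moment n).trans_le (le_iSup (fun n => ∫⁻ y, W y ∂(κ ^ n) x) n)
  have h_visit : ∀ᵐ ω ∂chainLaw κ (Measure.dirac x), ∀ k : ℕ,
      (∃ᶠ n in atTop, W (ω n) < k) → ∃ᶠ n in atTop, ω n ∈ A := by
    refine ae_all_iff.2 fun k => ?_
    obtain ⟨φ, hψφ, hφ⟩ := h_minor k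
    have hφA : 0 < φ A := pos_iff_ne_zero.2 fun h_zero => hψA.ne' (hψφ h_zero)
    exact hchain.ae_frequently_mem (B := {y | W y < k}) (c := (min (φ A) 1).toReal) hA
      (ENNReal.toReal_pos (lt_min hφA one_pos).ne' (by simp))
      fun y hy => ENNReal.toReal_mono (measure_ne_top _ _) ((min_le_left _ _).trans (hφ y hy A))
  filter_upwards [h_return, h_visit] with ω ⟨k, hk⟩ hω using hω k hk

end Recurrence

section AutoregressiveKernel

instance instIsMarkovKernelAr1Kernel (θ : ℝ) : IsMarkovKernel (ar1Kernel θ) :=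
  isMarkovKernel_ar1Kernel θ

lemma ar1Kernel_apply (θ x : ℝ) : ar1Kernel θ x = gaussianReal (θ * x) 1 := rfl

lemma gaussianReal_bind_ar1Kernel (θ m : ℝ) (v : ℝ≥0) :
    (gaussianReal m v).bind (ar1Kernel θ) = gaussianReal (θ * m) ((θ ^ 2).toNNReal * v + 1) := by
  have h_scale : (gaussianReal m v).map (θ * ·) =
      gaussianReal (θ * m) ((θ ^ 2).toNNReal * v) := by
    rw [gaussianReal_map_const_mul, Real.toNNReal_of_nonneg (sq_nonneg θ)]
  rw [← add_zero (θ * m), ← gaussianReal_conv_gaussianReal, ← h_scale]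
  refine Measure.ext_of_lintegral _ fun f hf => ?_
  have h_inner : Measurable fun x => ∫⁻ y, f (x + y) ∂gaussianReal 0 1 :=
    (hf.comp measurable_add).lintegral_prod_right'
  rw [Measure.lintegral_bind (by fun_prop) hf.aemeasurable, Measure.lintegral_conv hf,
    lintegral_map h_inner (by fun_prop)]
  refine lintegral_congr fun x => ?_
  rw [ar1Kernel_apply, ← lintegral_map (f := f) (g := fun y => θ * x + y) hf (by fun_prop),
    gaussianReal_map_const_add, zero_add]

/-- The variance of the state of the chain at time `n`, given the initial state. -/
noncomputable def ar1Var (θ : ℝ) (n : ℕ) : ℝ≥0 := ∑ i ∈ Finset.range n, (θ ^ 2).toNNReal ^ i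

lemma one_le_ar1Var_succ (θ : ℝ) (n : ℕ) : 1 ≤ ar1Var θ (n + 1) := by
  simp [ar1Var, Finset.sum_range_succ']

lemma pow_ar1Kernel_apply (θ : ℝ) (n : ℕ) (x : ℝ) :
    (ar1Kernel θ ^ n) x = gaussianReal (θ ^ n * x) (ar1Var θ n) := by
  induction n with
  | zero =>
    rw [pow_zero]
    exact (Kernel.id_apply x).trans (by simp [ar1Var])
  | succ n ih =>
    rw [add_comm n, Kernel.pow_add, pow_one, Kernel.comp_apply, ih, gaussianReal_bind_ar1Kernel]
    congr 1
    · ring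
    · rw [ar1Var, ar1Var, add_comm 1, Finset.sum_range_succ', Finset.mul_sum]
      simp [pow_succ']

/-- The variance of the invariant law of the chain with parameter `θ`, for `|θ| < 1`. -/
noncomputable def ar1InvVar (θ : ℝ) : ℝ≥0 := Real.toNNReal (1 / (1 - θ ^ 2))

lemma one_sub_sq_pos {θ : ℝ} (hθ : |θ| < 1) : 0 < 1 - θ ^ 2 :=
  sub_pos.2 ((sq_lt_one_iff_abs_lt_one θ).2 hθ)

lemma coe_ar1InvVar {θ : ℝ} (hθ : |θ| < 1) : (ar1InvVar θ : ℝ) = 1 / (1 - θ ^ 2) :=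
  Real.coe_toNNReal _ (one_div_pos.2 (one_sub_sq_pos hθ)).le

lemma ar1InvVar_pos {θ : ℝ} (hθ : |θ| < 1) : 0 < ar1InvVar θ :=
  Real.toNNReal_pos.2 (one_div_pos.2 (one_sub_sq_pos hθ))

lemma coe_ar1Var {θ : ℝ} (hθ : |θ| < 1) (n : ℕ) :
    (ar1Var θ n : ℝ) = ar1InvVar θ * (1 - (θ ^ n) ^ 2) := by
  have h_sum : (ar1Var θ n : ℝ) = ∑ i ∈ Finset.range n, (θ ^ 2) ^ i := by
    simp [ar1Var, sq_nonneg]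
  rw [h_sum, geom_sum_eq (sub_pos.1 (one_sub_sq_pos hθ)).ne, coe_ar1InvVar hθ, ← neg_div_neg_eq]
  ring

lemma ar1Var_le {θ : ℝ} (hθ : |θ| < 1) (n : ℕ) : ar1Var θ n ≤ ar1InvVar θ := by
  rw [← NNReal.coe_le_coe, coe_ar1Var hθ]
  exact mul_le_of_le_one_right NNReal.zero_le_coe (sub_le_self _ (sq_nonneg _))

lemma invariant_ar1Kernel {θ : ℝ} (hθ : |θ| < 1) :
    Kernel.Invariant (ar1Kernel θ) (gaussianReal 0 (ar1InvVar θ)) := by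
  have h_fixed : (θ ^ 2).toNNReal * ar1InvVar θ + 1 = ar1InvVar θ := by
    have := (one_sub_sq_pos hθ).ne'
    rw [← NNReal.coe_inj]
    push_cast
    rw [coe_ar1InvVar hθ, Real.coe_toNNReal _ (sq_nonneg θ)]
    field_simp
    ring
  rw [Kernel.Invariant, gaussianReal_bind_ar1Kernel, mul_zero, h_fixed]

/-- A constant `c` for which `c * (1 + |x| ^ p)` bounds the absolute moments of order `p` of all the
states of the chain started at `x`. -/
noncomputable def ar1MomentBound (θ p : ℝ) : ℝ :=
  2 ^ p * (1 + √(ar1InvVar θ) ^ p * gaussianAbsMoment p)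

lemma ar1MomentBound_nonneg (θ p : ℝ) : 0 ≤ ar1MomentBound θ p := by
  have := gaussianAbsMoment_nonneg p
  unfold ar1MomentBound
  positivity

lemma lintegral_abs_rpow_pow_ar1Kernel_le {θ : ℝ} (hθ : |θ| < 1) {p : ℝ} (hp : 0 ≤ p) (n : ℕ)
    (x : ℝ) :
    ∫⁻ y, ENNReal.ofReal (|y| ^ p) ∂((ar1Kernel θ ^ n) x) ≤
      ENNReal.ofReal (ar1MomentBound θ p * (1 + |x| ^ p)) := by
  rw [pow_ar1Kernel_apply]
  refine (lintegral_abs_rpow_gaussianReal_le _ _ hp).trans (ENNReal.ofReal_le_ofReal ?_)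
  have h_moment := gaussianAbsMoment_nonneg p
  have h_mean : |θ ^ n * x| ^ p ≤ |x| ^ p := by
    refine Real.rpow_le_rpow (abs_nonneg _) ?_ hp
    rw [abs_mul, abs_pow]
    exact mul_le_of_le_one_left (abs_nonneg _) (pow_le_one₀ (abs_nonneg _) hθ.le)
  have h_var : √(ar1Var θ n) ^ p * gaussianAbsMoment p ≤
      √(ar1InvVar θ) ^ p * gaussianAbsMoment p := by
    gcongr
    exact_mod_cast ar1Var_le hθ n
  calc 2 ^ p * (|θ ^ n * x| ^ p + √(ar1Var θ n) ^ p * gaussianAbsMoment p)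
      ≤ 2 ^ p * (|x| ^ p + √(ar1InvVar θ) ^ p * gaussianAbsMoment p) := by gcongr
    _ ≤ 2 ^ p * ((1 + √(ar1InvVar θ) ^ p * gaussianAbsMoment p) * (1 + |x| ^ p)) := by
        have : 0 ≤ √(ar1InvVar θ) ^ p * gaussianAbsMoment p * |x| ^ p := by positivity
        gcongr
        linarith
    _ = ar1MomentBound θ p * (1 + |x| ^ p) := by rw [ar1MomentBound, mul_assoc]

lemma ar1Kernel_absolutelyContinuous_volume (θ x : ℝ) : ar1Kernel θ x ≪ volume :=
  gaussianReal_absolutelyContinuous _ one_ne_zero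

lemma volume_absolutelyContinuous_ar1Kernel (θ x : ℝ) : volume ≪ ar1Kernel θ x :=
  gaussianReal_absolutelyContinuous' _ one_ne_zero

lemma isAperiodic_ar1Kernel (θ : ℝ) : IsAperiodic (ar1Kernel θ) :=
  isAperiodic_of_equiv (ar1Kernel_absolutelyContinuous_volume θ)
    (volume_absolutelyContinuous_ar1Kernel θ)

lemma exists_le_ar1Kernel_of_abs_le (θ R : ℝ) :
    ∃ φ : Measure ℝ, volume ≪ φ ∧ ∀ x, |x| ≤ R → φ ≤ ar1Kernel θ x := by
  let g (y : ℝ) : ℝ := (√(2 * Real.pi))⁻¹ * Real.exp (-(|y| + |θ| * R) ^ 2 / 2)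
  have hg_pos (y : ℝ) : 0 < g y := by positivity
  refine ⟨volume.withDensity fun y => ENNReal.ofReal (g y), ?_, fun x hx => ?_⟩
  · exact withDensity_absolutelyContinuous' (by fun_prop)
      (ae_of_all _ fun y => (ENNReal.ofReal_pos.2 (hg_pos y)).ne')
  · rw [ar1Kernel_apply, gaussianReal_of_var_ne_zero _ one_ne_zero]
    refine withDensity_mono (ae_of_all _ fun y => ENNReal.ofReal_le_ofReal ?_)
    have h_dist : |y - θ * x| ≤ |y| + |θ| * R := by
      refine (abs_sub _ _).trans ?_
      rw [abs_mul]
      gcongr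
    have h_sq : (y - θ * x) ^ 2 ≤ (|y| + |θ| * R) ^ 2 := by
      rw [← sq_abs (y - θ * x)]
      gcongr
    simp only [gaussianPDFReal, NNReal.coe_one, mul_one, g]
    gcongr

lemma isHarrisRecurrent_ar1Kernel {θ : ℝ} (hθ : |θ| < 1) : IsHarrisRecurrent (ar1Kernel θ) := by
  refine isHarrisRecurrent_of_lintegral_pow_le
    (isMaximalIrreducibilityMeasure_of_equiv (ar1Kernel_absolutelyContinuous_volume θ)
      (volume_absolutelyContinuous_ar1Kernel θ))
    (W := fun y => ENNReal.ofReal (|y| ^ (1 : ℝ))) (by fun_prop) (fun x => ?_) fun k => ?_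
  · exact ne_top_of_le_ne_top ENNReal.ofReal_ne_top
      (iSup_le fun n => lintegral_abs_rpow_pow_ar1Kernel_le hθ zero_le_one n x)
  · obtain ⟨φ, hφ, hφ_le⟩ := exists_le_ar1Kernel_of_abs_le θ k
    refine ⟨φ, hφ, fun x hx => hφ_le x ?_⟩
    rw [Real.rpow_one, ← ENNReal.ofReal_natCast,
      ENNReal.ofReal_lt_ofReal_iff_of_nonneg (abs_nonneg _)] at hx
    exact hx.le

lemma isPositiveHarris_ar1Kernel {θ : ℝ} (hθ : |θ| < 1) : IsPositiveHarris (ar1Kernel θ) :=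
  ⟨isHarrisRecurrent_ar1Kernel hθ, _, inferInstance, invariant_ar1Kernel hθ⟩

end AutoregressiveKernel

section GeometricErgodicity

lemma abs_sub_le_abs_log_sub_mul {p q : ℝ} (hp : 0 < p) (hq : 0 < q) :
    |p - q| ≤ |Real.log p - Real.log q| * (p + q) := by
  wlog h : q ≤ p generalizing p q
  · rw [abs_sub_comm, abs_sub_comm (Real.log p), add_comm]
    exact this hq hp (le_of_not_ge h)
  have h_log : Real.log q ≤ Real.log p := Real.log_le_log hq h
  have h_ratio : Real.log q - Real.log p ≤ q / p - 1 := by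
    rw [← Real.log_div hq.ne' hp.ne']
    exact Real.log_le_sub_one_of_pos (by positivity)
  have h_mul : p * (Real.log q - Real.log p) ≤ q - p :=
    (mul_le_mul_of_nonneg_left h_ratio hp.le).trans_eq (by field_simp)
  rw [abs_of_nonneg (by linarith), abs_of_nonneg (by linarith)]
  nlinarith

section WithDensity

variable {α : Type*} [MeasurableSpace α] {μ : Measure α} {p q g U V : α → ℝ}

lemma integrable_withDensity_ofReal_iff (hp : Measurable p) (hp_nonneg : ∀ x, 0 ≤ p x) :
    Integrable g (μ.withDensity fun x => ENNReal.ofReal (p x)) ↔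
      Integrable (fun x => p x * g x) μ := by
  rw [integrable_withDensity_iff_integrable_smul' hp.ennreal_ofReal
    (ae_of_all _ fun _ => ENNReal.ofReal_lt_top)]
  simp only [ENNReal.toReal_ofReal (hp_nonneg _), smul_eq_mul]

lemma integral_withDensity_ofReal (hp : Measurable p) (hp_nonneg : ∀ x, 0 ≤ p x) :
    ∫ x, g x ∂(μ.withDensity fun x => ENNReal.ofReal (p x)) = ∫ x, p x * g x ∂μ := by
  rw [integral_withDensity_eq_integral_toReal_smul hp.ennreal_ofReal
    (ae_of_all _ fun _ => ENNReal.ofReal_lt_top)]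
  simp only [ENNReal.toReal_ofReal (hp_nonneg _), smul_eq_mul]

lemma abs_integral_withDensity_sub_le (hp : Measurable p) (hq : Measurable q)
    (hp_pos : ∀ x, 0 < p x) (hq_pos : ∀ x, 0 < q x)
    (hg_p : Integrable g (μ.withDensity fun x => ENNReal.ofReal (p x)))
    (hg_q : Integrable g (μ.withDensity fun x => ENNReal.ofReal (q x)))
    (hU_p : Integrable U (μ.withDensity fun x => ENNReal.ofReal (p x)))
    (hU_q : Integrable U (μ.withDensity fun x => ENNReal.ofReal (q x)))
    (hgU : ∀ x, |g x| * |Real.log (p x) - Real.log (q x)| ≤ U x) :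
    |∫ x, g x ∂(μ.withDensity fun x => ENNReal.ofReal (p x)) -
        ∫ x, g x ∂(μ.withDensity fun x => ENNReal.ofReal (q x))| ≤
      ∫ x, U x ∂(μ.withDensity fun x => ENNReal.ofReal (p x)) +
        ∫ x, U x ∂(μ.withDensity fun x => ENNReal.ofReal (q x)) := by
  have hp_nonneg x := (hp_pos x).le
  have hq_nonneg x := (hq_pos x).le
  rw [integrable_withDensity_ofReal_iff hp hp_nonneg] at hg_p hU_p
  rw [integrable_withDensity_ofReal_iff hq hq_nonneg] at hg_q hU_q
  simp only [integral_withDensity_ofReal hp hp_nonneg, integral_withDensity_ofReal hq hq_nonneg]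
  rw [← integral_sub hg_p hg_q, ← integral_add hU_p hU_q]
  refine abs_integral_le_integral_abs.trans
    (integral_mono (hg_p.sub hg_q).abs (hU_p.add hU_q) fun x => ?_)
  calc |p x * g x - q x * g x|
      = |g x| * |p x - q x| := by rw [← sub_mul, abs_mul, mul_comm]
    _ ≤ |g x| * (|Real.log (p x) - Real.log (q x)| * (p x + q x)) := by
        gcongr
        exact abs_sub_le_abs_log_sub_mul (hp_pos x) (hq_pos x)
    _ ≤ U x * (p x + q x) := by
        rw [← mul_assoc]
        exact mul_le_mul_of_nonneg_right (hgU x) (add_pos (hp_pos x) (hq_pos x)).le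
    _ = p x * U x + q x * U x := by ring

lemma fDist_withDensity_le (hp : Measurable p) (hq : Measurable q)
    (hp_pos : ∀ x, 0 < p x) (hq_pos : ∀ x, 0 < q x)
    (hV_p : Integrable V (μ.withDensity fun x => ENNReal.ofReal (p x)))
    (hV_q : Integrable V (μ.withDensity fun x => ENNReal.ofReal (q x)))
    (hU_p : Integrable U (μ.withDensity fun x => ENNReal.ofReal (p x)))
    (hU_q : Integrable U (μ.withDensity fun x => ENNReal.ofReal (q x)))
    (hVU : ∀ x, V x * |Real.log (p x) - Real.log (q x)| ≤ U x) :
    fDist V (μ.withDensity fun x => ENNReal.ofReal (p x))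
        (μ.withDensity fun x => ENNReal.ofReal (q x)) ≤
      ENNReal.ofReal (∫ x, U x ∂(μ.withDensity fun x => ENNReal.ofReal (p x)) +
        ∫ x, U x ∂(μ.withDensity fun x => ENNReal.ofReal (q x))) := by
  refine iSup_le fun g => iSup_le fun hg => iSup_le fun hgV => ?_
  have hg_le (ν : Measure α) (hV : Integrable V ν) : Integrable g ν :=
    hV.mono' hg.aestronglyMeasurable (ae_of_all _ fun x => (hgV x).le)
  rw [if_pos ⟨hg_le _ hV_p, hg_le _ hV_q⟩]
  exact ENNReal.ofReal_le_ofReal (abs_integral_withDensity_sub_le hp hq hp_pos hq_pos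
    (hg_le _ hV_p) (hg_le _ hV_q) hU_p hU_q fun x =>
      (mul_le_mul_of_nonneg_right (hgV x).le (abs_nonneg _)).trans (hVU x))

end WithDensity

lemma isVGeometricallyErgodic_of_fDist_le {S : Type*} [MeasurableSpace S] {κ : Kernel S S}
    [IsMarkovKernel κ] {μ : Measure S} [IsProbabilityMeasure μ] {V : S → ℝ}
    (hκ : IsPositiveHarris κ) (hμ : Kernel.Invariant κ μ) {a : ℝ} (ha0 : 0 ≤ a) (ha1 : a < 1)
    (h : ∀ x, ∃ B : ℝ, ∀ n : ℕ, fDist V ((κ ^ (n + 1)) x) μ ≤ ENNReal.ofReal (a ^ (n + 1) * B)) :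
    IsVGeometricallyErgodic κ μ V := by
  refine ⟨hκ, inferInstance, hμ, 2 / (1 + a), (one_lt_div (by positivity)).2 (by linarith),
    fun x => ?_⟩
  obtain ⟨B, hB⟩ := h x
  set r := 2 / (1 + a)
  have hr : 0 ≤ r := by positivity
  have hra : r * a < 1 := by
    rw [div_mul_eq_mul_div, div_lt_one (by positivity)]
    linarith
  have hsum : Summable fun n : ℕ => (r * a) ^ (n + 1) * B :=
    ((summable_nat_add_iff 1).2 (summable_geometric_of_lt_one (by positivity) hra)).mul_right B
  refine lt_of_le_of_lt (ENNReal.tsum_le_tsum fun n => ?_) hsum.tsum_ofReal_lt_top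
  refine (mul_le_mul_right (hB n) _).trans_eq ?_
  rw [← ENNReal.ofReal_mul (by positivity), mul_pow, mul_assoc]

lemma log_gaussianPDFReal (m : ℝ) {v : ℝ≥0} (hv : v ≠ 0) (y : ℝ) :
    Real.log (gaussianPDFReal m v y) =
      -(Real.log (2 * Real.pi * v) / 2) - (y - m) ^ 2 / (2 * v) := by
  have hv_pos : (0 : ℝ) < v := by exact_mod_cast pos_iff_ne_zero.2 hv
  rw [gaussianPDFReal, Real.log_mul (by positivity) (by positivity), Real.log_inv,
    Real.log_sqrt (by positivity), Real.log_exp]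
  ring

lemma abs_sq_sub_sub_mul_sq_le {τ : ℝ} (hτ : |τ| ≤ 1) (x y : ℝ) :
    |(y - τ * x) ^ 2 - (1 - τ ^ 2) * y ^ 2| ≤ 2 * |τ| * (x ^ 2 + y ^ 2) := by
  have h_sq : τ ^ 2 ≤ |τ| := by
    rw [← sq_abs]
    exact pow_le_of_le_one (abs_nonneg _) hτ two_ne_zero
  have h_cross : |2 * x * y| ≤ x ^ 2 + y ^ 2 :=
    abs_le.2 ⟨by linarith [sq_nonneg (x + y)], two_mul_le_add_sq x y⟩
  calc |(y - τ * x) ^ 2 - (1 - τ ^ 2) * y ^ 2|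
      = |τ ^ 2 * (x ^ 2 + y ^ 2) - τ * (2 * x * y)| := by ring_nf
    _ ≤ |τ ^ 2 * (x ^ 2 + y ^ 2)| + |τ * (2 * x * y)| := abs_sub _ _
    _ = τ ^ 2 * (x ^ 2 + y ^ 2) + |τ| * |2 * x * y| := by
        rw [abs_mul τ, abs_of_nonneg (by positivity : 0 ≤ τ ^ 2 * (x ^ 2 + y ^ 2))]
    _ ≤ |τ| * (x ^ 2 + y ^ 2) + |τ| * (x ^ 2 + y ^ 2) := by gcongr
    _ = 2 * |τ| * (x ^ 2 + y ^ 2) := by ring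

lemma abs_log_gaussianPDFReal_sub_le {u v : ℝ≥0} {τ : ℝ} (hu : 1 ≤ u)
    (huv : (u : ℝ) = v * (1 - τ ^ 2)) (x y : ℝ) :
    |Real.log (gaussianPDFReal (τ * x) u y) - Real.log (gaussianPDFReal 0 v y)| ≤
      |τ| * (v + x ^ 2 + 1) * (1 + y ^ 2) := by
  have hu' : (1 : ℝ) ≤ u := by exact_mod_cast hu
  have hv_nonneg : (0 : ℝ) ≤ v := v.2
  have hτ_sq : 0 < 1 - τ ^ 2 := by
    by_contra! h
    linarith [mul_nonpos_of_nonneg_of_nonpos hv_nonneg h]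
  have hτ : |τ| ≤ 1 := (sq_le_one_iff_abs_le_one τ).1 (by linarith)
  have huv_le : (u : ℝ) ≤ v := huv ▸ mul_le_of_le_one_right hv_nonneg (by linarith [sq_nonneg τ])
  have hu_pos : (0 : ℝ) < u := by linarith
  have hv_pos : (0 : ℝ) < v := by linarith
  have h_log : Real.log (2 * Real.pi * v) - Real.log (2 * Real.pi * u) ≤ v * τ ^ 2 := by
    rw [← Real.log_div (by positivity) (by positivity), mul_div_mul_left _ _ (by positivity)]
    calc Real.log (v / u) ≤ v / u - 1 := Real.log_le_sub_one_of_pos (by positivity)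
      _ = v * τ ^ 2 / u := by rw [div_sub_one (by positivity), huv]; ring
      _ ≤ v * τ ^ 2 := div_le_self (by positivity) hu'
  have h_log_nonneg : 0 ≤ Real.log (2 * Real.pi * v) - Real.log (2 * Real.pi * u) :=
    sub_nonneg.2 (Real.log_le_log (by positivity) (by gcongr))
  have h_quad : |(y - τ * x) ^ 2 / (2 * u) - y ^ 2 / (2 * v)| ≤ |τ| * (x ^ 2 + y ^ 2) := by
    have h_inv : y ^ 2 / (2 * v) = (1 - τ ^ 2) * y ^ 2 / (2 * u) := by
      rw [huv]
      field_simp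
    rw [h_inv, ← sub_div, abs_div, abs_of_pos (by positivity : (0 : ℝ) < 2 * u),
      div_le_iff₀ (by positivity)]
    nlinarith [abs_sq_sub_sub_mul_sq_le hτ x y,
      (by positivity : 0 ≤ |τ| * (x ^ 2 + y ^ 2))]
  have h_sq : v * τ ^ 2 ≤ v * |τ| := by
    rw [← sq_abs]
    gcongr
    exact pow_le_of_le_one (abs_nonneg _) hτ two_ne_zero
  rw [log_gaussianPDFReal _ (by exact_mod_cast hu_pos.ne'),
    log_gaussianPDFReal _ (by exact_mod_cast hv_pos.ne'), sub_zero]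
  have h_nonneg : 0 ≤ |τ| * (v * y ^ 2 + x ^ 2 * y ^ 2 + 1) := by positivity
  rw [abs_le] at h_quad ⊢
  constructor <;> nlinarith

lemma one_add_rpow_mul_one_add_sq_le {s : ℝ} (hs : 0 ≤ s) (y : ℝ) :
    (1 + |y| ^ s) * (1 + y ^ 2) ≤ 2 * (1 + |y| ^ (s + 2)) := by
  have h_mul : |y| ^ (s + 2) = |y| ^ s * y ^ 2 := by
    rw [Real.rpow_add_of_nonneg (abs_nonneg _) hs zero_le_two, Real.rpow_two, sq_abs]
  have h_same_side : 0 ≤ (|y| ^ s - 1) * (y ^ 2 - 1) := by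
    rcases le_total |y| 1 with hy | hy
    · exact mul_nonneg_of_nonpos_of_nonpos
        (sub_nonpos.2 (Real.rpow_le_one (abs_nonneg _) hy hs))
        (sub_nonpos.2 ((sq_le_one_iff_abs_le_one y).2 hy))
    · exact mul_nonneg (sub_nonneg.2 (Real.one_le_rpow hy hs))
        (sub_nonneg.2 ((one_le_sq_iff_one_le_abs y).2 hy))
  rw [h_mul]
  linarith

lemma integrable_mul_one_add_abs_rpow_gaussianReal (a m : ℝ) (v : ℝ≥0) {p : ℝ} (hp : 0 ≤ p) :
    Integrable (fun y => a * (1 + |y| ^ p)) (gaussianReal m v) :=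
  ((integrable_const _).add (integrable_abs_rpow_gaussianReal m v hp)).const_mul _

lemma integral_mul_one_add_abs_rpow_gaussianReal (a m : ℝ) (v : ℝ≥0) {p : ℝ} (hp : 0 ≤ p) :
    ∫ y, a * (1 + |y| ^ p) ∂(gaussianReal m v) =
      a * (1 + ∫ y, |y| ^ p ∂(gaussianReal m v)) := by
  rw [integral_const_mul, integral_add (integrable_const _)
    (integrable_abs_rpow_gaussianReal m v hp), integral_const, probReal_univ, one_smul]

lemma fDist_gaussianReal_le {u v : ℝ≥0} {τ : ℝ} (hu : 1 ≤ u) (huv : (u : ℝ) = v * (1 - τ ^ 2))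
    {s C : ℝ} (hs : 0 ≤ s) (hC : 0 ≤ C) (x : ℝ) :
    fDist (fun y => C * (1 + |y| ^ s)) (gaussianReal (τ * x) u) (gaussianReal 0 v) ≤
      ENNReal.ofReal (|τ| * (2 * C * (v + x ^ 2 + 1)) *
        ((1 + ∫ y, |y| ^ (s + 2) ∂(gaussianReal (τ * x) u)) +
          (1 + ∫ y, |y| ^ (s + 2) ∂(gaussianReal 0 v)))) := by
  have hu_ne : u ≠ 0 := (zero_lt_one.trans_le hu).ne'
  have hv_ne : v ≠ 0 := by
    rintro rfl
    exact hu_ne (by simpa using huv)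
  have hs' : 0 ≤ s + 2 := by positivity
  set a : ℝ := |τ| * (2 * C * (v + x ^ 2 + 1))
  have h_bound (y : ℝ) : C * (1 + |y| ^ s) *
      |Real.log (gaussianPDFReal (τ * x) u y) - Real.log (gaussianPDFReal 0 v y)| ≤
        a * (1 + |y| ^ (s + 2)) :=
    calc _ ≤ C * (1 + |y| ^ s) * (|τ| * (v + x ^ 2 + 1) * (1 + y ^ 2)) := by
          gcongr
          exact abs_log_gaussianPDFReal_sub_le hu huv x y
      _ = |τ| * C * (v + x ^ 2 + 1) * ((1 + |y| ^ s) * (1 + y ^ 2)) := by ring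
      _ ≤ |τ| * C * (v + x ^ 2 + 1) * (2 * (1 + |y| ^ (s + 2))) := by
          exact mul_le_mul_of_nonneg_left (one_add_rpow_mul_one_add_sq_le hs y) (by positivity)
      _ = a * (1 + |y| ^ (s + 2)) := by ring
  have h_fDist := fDist_withDensity_le (μ := volume)
    (measurable_gaussianPDFReal (τ * x) u) (measurable_gaussianPDFReal 0 v)
    (gaussianPDFReal_pos _ _ · hu_ne) (gaussianPDFReal_pos _ _ · hv_ne)
    (V := fun y => C * (1 + |y| ^ s)) (U := fun y => a * (1 + |y| ^ (s + 2)))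
  simp only [← gaussianPDF.eq_1, ← gaussianReal_of_var_ne_zero _ hu_ne,
    ← gaussianReal_of_var_ne_zero _ hv_ne,
    integral_mul_one_add_abs_rpow_gaussianReal _ _ _ hs', ← mul_add] at h_fDist
  exact h_fDist (integrable_mul_one_add_abs_rpow_gaussianReal _ _ _ hs)
    (integrable_mul_one_add_abs_rpow_gaussianReal _ _ _ hs)
    (integrable_mul_one_add_abs_rpow_gaussianReal _ _ _ hs')
    (integrable_mul_one_add_abs_rpow_gaussianReal _ _ _ hs') h_bound

lemma integral_abs_rpow_pow_ar1Kernel_le {θ : ℝ} (hθ : |θ| < 1) {p : ℝ} (hp : 0 ≤ p) (n : ℕ)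
    (x : ℝ) :
    ∫ y, |y| ^ p ∂((ar1Kernel θ ^ n) x) ≤ ar1MomentBound θ p * (1 + |x| ^ p) := by
  have := ar1MomentBound_nonneg θ p
  rw [integral_eq_lintegral_of_nonneg_ae (ae_of_all _ fun _ => by positivity)
    (by fun_prop : Measurable _).aestronglyMeasurable]
  exact ENNReal.toReal_le_of_le_ofReal (by positivity)
    (lintegral_abs_rpow_pow_ar1Kernel_le hθ hp n x)

lemma isVGeometricallyErgodic_ar1Kernel {θ : ℝ} (hθ : |θ| < 1) {s C : ℝ} (hs : 0 ≤ s)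
    (hC : 0 ≤ C) :
    IsVGeometricallyErgodic (ar1Kernel θ) (gaussianReal 0 (ar1InvVar θ))
      fun x => C * (1 + |x| ^ s) := by
  refine isVGeometricallyErgodic_of_fDist_le (isPositiveHarris_ar1Kernel hθ)
    (invariant_ar1Kernel hθ) (abs_nonneg θ) hθ fun x =>
      ⟨2 * C * (ar1InvVar θ + x ^ 2 + 1) *
        ((1 + ar1MomentBound θ (s + 2) * (1 + |x| ^ (s + 2))) +
          (1 + ∫ y, |y| ^ (s + 2) ∂(gaussianReal 0 (ar1InvVar θ)))), fun n => ?_⟩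
  have h_moment := integral_abs_rpow_pow_ar1Kernel_le hθ (by positivity : 0 ≤ s + 2) (n + 1) x
  rw [pow_ar1Kernel_apply] at h_moment ⊢
  refine (fDist_gaussianReal_le (one_le_ar1Var_succ θ n) (coe_ar1Var hθ _) hs hC x).trans ?_
  rw [abs_pow, mul_assoc]
  gcongr

end GeometricErgodicity

section RandomIteration

variable {Ω S R : Type*} [MeasurableSpace Ω] [MeasurableSpace S] [MeasurableSpace R]
  {P : Measure Ω} {X : ℕ → Ω → S} {W : ℕ → Ω → R} {F : S → R → S}

lemma aemeasurable_of_recursion (hF : Measurable (Function.uncurry F))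
    (hW : ∀ n, AEMeasurable (W n) P) (hX₀ : AEMeasurable (X 0) P)
    (hX : ∀ n ω, X (n + 1) ω = F (X n ω) (W n ω)) (n : ℕ) : AEMeasurable (X n) P := by
  induction n with
  | zero => exact hX₀
  | succ n ih =>
    rw [funext (hX n)]
    exact hF.comp_aemeasurable (ih.prodMk (hW n))

variable [IsProbabilityMeasure P]

lemma indepFun_prodMk_left {α β γ : Type*} [MeasurableSpace α] [MeasurableSpace β]
    [MeasurableSpace γ] {f : Ω → α} {g : Ω → β} {h : Ω → γ} (hf : AEMeasurable f P)
    (hg : AEMeasurable g P) (hh : AEMeasurable h P)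
    (hf_gh : IndepFun f (fun ω => (g ω, h ω)) P) (hgh : IndepFun g h P) :
    IndepFun (fun ω => (f ω, g ω)) h P := by
  have hfg : IndepFun f g P := hf_gh.comp measurable_id measurable_fst
  rw [indepFun_iff_map_prod_eq_prod_map_map (by fun_prop) (by fun_prop)] at *
  rw [hfg]
  refine MeasurableEquiv.prodAssoc.map_measurableEquiv_injective ?_
  rw [Measure.prodAssoc_prod, ← hgh, ← hf_gh,
    AEMeasurable.map_map_of_aemeasurable (by fun_prop) (by fun_prop)]
  rfl

lemma indepFun_initialSegment_of_recursion (hF : Measurable (Function.uncurry F))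
    (hW : ∀ n, AEMeasurable (W n) P) (hX₀ : AEMeasurable (X 0) P) (hW_indep : iIndepFun W P)
    (hX_W : IndepFun (X 0) (fun ω n => W n ω) P)
    (hX : ∀ n ω, X (n + 1) ω = F (X n ω) (W n ω)) (n : ℕ) :
    IndepFun (fun ω => initialSegment n fun k => X k ω) (W n) P := by
  let past (ω : Ω) (j : Finset.range n) : R := W j ω
  have h_past_noise : IndepFun past (W n) P :=
    (hW_indep.indepFun_finset₀ (Finset.range n) {n} (by simp) hW).comp measurable_id
      (by fun_prop : Measurable fun h : ({n} : Finset ℕ) → R => h ⟨n, Finset.mem_singleton_self n⟩)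
  have h_init : IndepFun (X 0) (fun ω => (past ω, W n ω)) P :=
    hX_W.comp measurable_id
      (by fun_prop : Measurable fun w : ℕ → R => ((fun j : Finset.range n => w j), w n))
  have h_indep := indepFun_prodMk_left hX₀ (aemeasurable_pi_lambda past fun j => hW j) (hW n)
    h_init h_past_noise
  rw [IndepFun_iff_Indep] at h_indep ⊢
  refine indep_of_indep_of_le_left h_indep ?_
  set m := MeasurableSpace.comap (fun ω => (X 0 ω, past ω)) inferInstance
  have h_pair : Measurable[m] fun ω => (X 0 ω, past ω) := comap_measurable _
  have hX_meas (i : ℕ) (hi : i ≤ n) : Measurable[m] (X i) := by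
    induction i with
    | zero => exact measurable_fst.comp h_pair
    | succ i ih =>
      have hW_meas : Measurable[m] (W i) :=
        (measurable_pi_apply (⟨i, Finset.mem_range.2 hi⟩ : Finset.range n)).comp
          (measurable_snd.comp h_pair)
      rw [funext (hX i)]
      exact hF.comp ((ih (by lia)).prodMk hW_meas)
  exact (measurable_pi_lambda (fun ω => initialSegment n fun k => X k ω)
    fun i => hX_meas i (Nat.le_of_lt_succ i.2)).comap_le

lemma lintegral_initialSegment_succ_of_recursion {ν : Measure R}
    (hF : Measurable (Function.uncurry F)) (hW : ∀ n, HasLaw (W n) ν P)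
    (hX₀ : AEMeasurable (X 0) P) (hW_indep : iIndepFun W P)
    (hX_W : IndepFun (X 0) (fun ω n => W n ω) P)
    (hX : ∀ n ω, X (n + 1) ω = F (X n ω) (W n ω)) (n : ℕ) {f : (Fin (n + 2) → S) → ℝ≥0∞}
    (hf : Measurable f) :
    ∫⁻ ω, f (initialSegment (n + 1) fun k => X k ω) ∂P =
      ∫⁻ ω, ∫⁻ w, f (Fin.snoc (α := fun _ => S) (initialSegment n fun k => X k ω)
        (F (X n ω) w)) ∂ν ∂P := by
  have : IsProbabilityMeasure ν := (hW 0).isProbabilityMeasure_iff.1 inferInstance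
  have hW_meas n := (hW n).aemeasurable
  let past (ω : Ω) : Fin (n + 1) → S := initialSegment n fun k => X k ω
  have h_past : AEMeasurable past P := (measurable_initialSegment n).comp_aemeasurable
    (aemeasurable_pi_lambda _ (aemeasurable_of_recursion hF hW_meas hX₀ hX))
  have h_joint : P.map (fun ω => (past ω, W n ω)) = (P.map past).prod ν := by
    rw [← (hW n).map_eq]
    exact (indepFun_iff_map_prod_eq_prod_map_map h_past (hW_meas n)).1
      (indepFun_initialSegment_of_recursion hF hW_meas hX₀ hW_indep hX_W hX n)
  let g (p : (Fin (n + 1) → S) × R) : ℝ≥0∞ :=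
    f (Fin.snoc (α := fun _ => S) p.1 (F (p.1 (Fin.last n)) p.2))
  have hg : Measurable g := hf.comp ((measurable_finSnoc (n + 1)).comp (measurable_fst.prodMk
    (hF.comp (by fun_prop : Measurable fun p : (Fin (n + 1) → S) × R => (p.1 (Fin.last n), p.2)))))
  calc ∫⁻ ω, f (initialSegment (n + 1) fun k => X k ω) ∂P
      = ∫⁻ ω, g (past ω, W n ω) ∂P := by
        simp only [g, past, initialSegment_succ, initialSegment_last, hX]
    _ = ∫⁻ p, g p ∂((P.map past).prod ν) := by
        rw [← h_joint, lintegral_map' hg.aemeasurable (h_past.prodMk (hW_meas n))]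
    _ = ∫⁻ x, ∫⁻ w, g (x, w) ∂ν ∂(P.map past) := lintegral_prod _ hg.aemeasurable
    _ = ∫⁻ ω, ∫⁻ w, g (past ω, w) ∂ν ∂P :=
        lintegral_map' hg.lintegral_prod_right'.aemeasurable h_past
    _ = _ := by simp only [g, past, initialSegment_last]

lemma isMarkovChain_map_of_recursion {κ : Kernel S S} [IsSFiniteKernel κ] {ν : Measure R}
    (hF : Measurable (Function.uncurry F)) (hκ : ∀ x, κ x = ν.map (F x))
    (hW : ∀ n, HasLaw (W n) ν P) (hX₀ : AEMeasurable (X 0) P) (hW_indep : iIndepFun W P)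
    (hX_W : IndepFun (X 0) (fun ω n => W n ω) P)
    (hX : ∀ n ω, X (n + 1) ω = F (X n ω) (W n ω)) :
    IsMarkovChain κ (P.map fun ω n => X n ω) := by
  intro n f hf
  have hX_meas : AEMeasurable (fun ω n => X n ω) P := aemeasurable_pi_lambda _ <|
    aemeasurable_of_recursion hF (fun n => (hW n).aemeasurable) hX₀ hX
  have h_meas : Measurable fun ω : ℕ → S =>
      ∫⁻ y, f (Fin.snoc (α := fun _ => S) (initialSegment n ω) y) ∂κ (ω n) := by
    simp only [← initialSegment_last n]
    exact (measurable_lintegral_finSnoc κ n hf).comp (measurable_initialSegment n)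
  have h_kernel (x : Fin (n + 1) → S) (a : S) :
      ∫⁻ y, f (Fin.snoc (α := fun _ => S) x y) ∂κ a =
        ∫⁻ w, f (Fin.snoc (α := fun _ => S) x (F a w)) ∂ν := by
    have hf_snoc : Measurable fun y => f (Fin.snoc (α := fun _ => S) x y) :=
      hf.comp ((measurable_finSnoc (n + 1)).comp measurable_prodMk_left)
    have hFa : Measurable (F a) := hF.comp measurable_prodMk_left
    rw [hκ, lintegral_map hf_snoc hFa]
  have hf_seg : Measurable fun ω : ℕ → S => f (initialSegment (n + 1) ω) :=
    hf.comp (measurable_initialSegment _)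
  rw [lintegral_map' hf_seg.aemeasurable hX_meas,
    lintegral_map' h_meas.aemeasurable hX_meas,
    lintegral_initialSegment_succ_of_recursion hF hW hX₀ hW_indep hX_W hX n hf]
  simp only [h_kernel]

end RandomIteration

lemma hasLaw_chainLaw_of_recursion {Ω : Type*} [MeasurableSpace Ω] {P : Measure Ω}
    [IsProbabilityMeasure P] {θ : ℝ} {X W : ℕ → Ω → ℝ} {ν : Measure ℝ}
    (hW : ∀ n, HasLaw (W n) (gaussianReal 0 1) P) (hX₀ : HasLaw (X 0) ν P)
    (hW_indep : iIndepFun W P) (hX_W : IndepFun (X 0) (fun ω n => W n ω) P)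
    (hX : ∀ n ω, X (n + 1) ω = θ * X n ω + W n ω) :
    HasLaw (fun ω n => X n ω) (chainLaw (ar1Kernel θ) ν) P := by
  have hF : Measurable (Function.uncurry fun x w : ℝ => θ * x + w) := by fun_prop
  have hX_meas : AEMeasurable (fun ω n => X n ω) P := aemeasurable_pi_lambda _ <|
    aemeasurable_of_recursion hF (fun n => (hW n).aemeasurable) hX₀.aemeasurable hX
  have : IsProbabilityMeasure ν := hX₀.isProbabilityMeasure_iff.1 inferInstance
  have := Measure.isProbabilityMeasure_map hX_meas
  refine ⟨hX_meas, IsMarkovChain.ext (isMarkovChain_map_of_recursion hF (fun x => ?_) hW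
    hX₀.aemeasurable hW_indep hX_W hX) (isMarkovChain_chainLaw _ _) ?_⟩
  · rw [ar1Kernel_apply, gaussianReal_map_const_add, zero_add]
  · rw [map_zero_chainLaw, AEMeasurable.map_map_of_aemeasurable
      (measurable_pi_apply 0).aemeasurable hX_meas]
    exact hX₀.map_eq

section BetaDistribution

variable {α β : ℝ}

lemma betaPDFReal_nonneg (hα : 0 < α) (hβ : 0 < β) (x : ℝ) : 0 ≤ betaPDFReal α β x := by
  by_cases hx : 0 < x ∧ x < 1
  · exact (betaPDFReal_pos hx.1 hx.2 hα hβ).le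
  · rw [betaPDFReal, if_neg hx]

lemma integrable_betaPDFReal (hα : 0 < α) (hβ : 0 < β) : Integrable (betaPDFReal α β) := by
  refine ⟨(measurable_betaPDFReal α β).aestronglyMeasurable, ?_⟩
  rw [hasFiniteIntegral_iff_ofReal (ae_of_all _ (betaPDFReal_nonneg hα hβ))]
  exact (lintegral_betaPDF_eq_one hα hβ).trans_lt ENNReal.one_lt_top

lemma integral_betaPDFReal (hα : 0 < α) (hβ : 0 < β) : ∫ x, betaPDFReal α β x = 1 := by
  rw [integral_eq_lintegral_of_nonneg_ae (ae_of_all _ (betaPDFReal_nonneg hα hβ))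
    (measurable_betaPDFReal α β).aestronglyMeasurable]
  exact congrArg ENNReal.toReal (lintegral_betaPDF_eq_one hα hβ)

lemma ae_mem_Ioo_betaMeasure (α β : ℝ) : ∀ᵐ x ∂(betaMeasure α β), x ∈ Set.Ioo (0 : ℝ) 1 := by
  have h_meas : Measurable (betaPDF α β) := (measurable_betaPDFReal α β).ennreal_ofReal
  rw [betaMeasure, ae_withDensity_iff h_meas]
  refine ae_of_all _ fun x hx => ?_
  by_contra h
  exact hx (by rw [betaPDF, betaPDFReal, if_neg (show ¬(0 < x ∧ x < 1) from h),
    ENNReal.ofReal_zero])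

lemma beta_add_one_left (hα : 0 < α) (hβ : 0 < β) :
    beta (α + 1) β = α / (α + β) * beta α β := by
  have hαβ : 0 < α + β := add_pos hα hβ
  have hΓ := (Real.Gamma_pos_of_pos hαβ).ne'
  rw [beta, beta, Real.Gamma_add_one hα.ne', add_right_comm, Real.Gamma_add_one hαβ.ne']
  field_simp

lemma beta_comm (α β : ℝ) : beta α β = beta β α := by
  rw [beta, beta, mul_comm, add_comm]

lemma betaPDFReal_one_sub (α β x : ℝ) : betaPDFReal α β (1 - x) = betaPDFReal β α x := by
  simp only [betaPDFReal, sub_pos, sub_lt_self_iff, sub_sub_cancel, beta_comm α β,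
    and_comm (a := x < 1)]
  split_ifs <;> ring

lemma mul_betaPDFReal (hα : 0 < α) (hβ : 0 < β) (x : ℝ) :
    x * betaPDFReal α β x = α / (α + β) * betaPDFReal (α + 1) β x := by
  rw [betaPDFReal, betaPDFReal, beta_add_one_left hα hβ]
  split_ifs with hx
  · have h_beta := (beta_pos hα hβ).ne'
    rw [add_sub_right_comm, Real.rpow_add_one hx.1.ne']
    field_simp
  · simp

lemma one_sub_mul_betaPDFReal (hα : 0 < α) (hβ : 0 < β) (x : ℝ) :
    (1 - x) * betaPDFReal α β x = β / (α + β) * betaPDFReal α (β + 1) x := by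
  rw [← betaPDFReal_one_sub β α, mul_betaPDFReal hβ hα, betaPDFReal_one_sub, add_comm β]

lemma sq_sub_div_mul_betaPDFReal (hα : 0 < α) (hβ : 0 < β) (m x : ℝ) :
    betaPDFReal (α + 1) (β + 1) x * ((x - m) ^ 2 / (x * (1 - x))) =
      (α + β) * (α + β + 1) / (α * β) *
        (α / (α + β) * ((α + 1) / (α + β + 1)) * betaPDFReal (α + 2) β x -
          2 * m * (α / (α + β)) * betaPDFReal (α + 1) β x + m ^ 2 * betaPDFReal α β x) := by
  by_cases hx : 0 < x ∧ x < 1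
  · have hx₀ := hx.1.ne'
    have hx₁ := (sub_pos.2 hx.2).ne'
    have h_mul := mul_betaPDFReal hα hβ x
    have h_mul_mul := mul_betaPDFReal (add_pos hα one_pos) hβ x
    have h_one_sub := one_sub_mul_betaPDFReal (add_pos hα one_pos) hβ x
    rw [add_assoc α 1 1, one_add_one_eq_two, add_right_comm] at h_mul_mul
    rw [add_right_comm] at h_one_sub
    have h_sq : α / (α + β) * ((α + 1) / (α + β + 1)) * betaPDFReal (α + 2) β x =
        x ^ 2 * betaPDFReal α β x := by
      rw [mul_assoc, ← h_mul_mul, mul_left_comm, ← h_mul]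
      ring
    have h_shift : betaPDFReal (α + 1) (β + 1) x =
        (α + β) * (α + β + 1) / (α * β) * (x * (1 - x)) * betaPDFReal α β x := by
      have h_first : betaPDFReal (α + 1) β x = (α + β) / α * (x * betaPDFReal α β x) := by
        rw [h_mul]
        field_simp
      rw [h_first] at h_one_sub
      field_simp at h_one_sub ⊢
      linear_combination -h_one_sub
    rw [h_sq, mul_assoc (2 * m), ← h_mul, h_shift]
    field_simp
    ring
  · simp only [betaPDFReal, if_neg hx, mul_zero, zero_mul, sub_zero, add_zero]

lemma integral_sq_sub_div_betaMeasure (hα : 0 < α) (hβ : 0 < β) :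
    Integrable (fun x => (x - α / (α + β)) ^ 2 / (x * (1 - x))) (betaMeasure (α + 1) (β + 1)) ∧
      ∫ x, (x - α / (α + β)) ^ 2 / (x * (1 - x)) ∂(betaMeasure (α + 1) (β + 1)) =
        1 / (α + β) := by
  set m := α / (α + β)
  have hα₁ : 0 < α + 1 := by positivity
  have hα₂ : 0 < α + 2 := by positivity
  have hβ₁ : 0 < β + 1 := by positivity
  have h_meas := measurable_betaPDFReal (α + 1) (β + 1)
  have h_nonneg := betaPDFReal_nonneg hα₁ hβ₁
  have h_sq := (integrable_betaPDFReal hα₂ hβ).const_mul (m * ((α + 1) / (α + β + 1)))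
  have h_mean := (integrable_betaPDFReal hα₁ hβ).const_mul (2 * m * m)
  have h_const := (integrable_betaPDFReal hα hβ).const_mul (m ^ 2)
  constructor
  · refine (integrable_withDensity_ofReal_iff h_meas h_nonneg).2 ?_
    simp only [sq_sub_div_mul_betaPDFReal hα hβ]
    exact ((h_sq.sub h_mean).add h_const).const_mul _
  · refine (integral_withDensity_ofReal h_meas h_nonneg).trans ?_
    simp only [sq_sub_div_mul_betaPDFReal hα hβ]
    rw [integral_const_mul, integral_add (by exact h_sq.sub h_mean) h_const,
      integral_sub h_sq h_mean]
    simp only [integral_const_mul, integral_betaPDFReal, hα, hβ, hα₁, hα₂, m]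
    field_simp
    ring

lemma betaPDFReal_add_one_add_one {x : ℝ} (hx : x ∈ Set.Ioo (0 : ℝ) 1) :
    betaPDFReal (α + 1) (β + 1) x = 1 / beta (α + 1) (β + 1) * (x ^ α * (1 - x) ^ β) := by
  rw [betaPDFReal, if_pos (show 0 < x ∧ x < 1 from hx), add_sub_cancel_right,
    add_sub_cancel_right, mul_assoc]

lemma div_add_mem_Ioo (hα : 0 < α) (hβ : 0 < β) : α / (α + β) ∈ Set.Ioo (0 : ℝ) 1 :=
  ⟨by positivity, (div_lt_one (by positivity)).2 (by linarith)⟩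

lemma one_sub_div_add (hα : 0 < α) (hβ : 0 < β) : 1 - α / (α + β) = β / (α + β) := by
  field_simp
  ring

lemma rpow_mul_one_sub_rpow_le (hα : 0 < α) (hβ : 0 < β) {x : ℝ} (hx : x ∈ Set.Ioo (0 : ℝ) 1) :
    x ^ α * (1 - x) ^ β ≤ (α / (α + β)) ^ α * (1 - α / (α + β)) ^ β := by
  obtain ⟨hx₀, hx₁⟩ : 0 < x ∧ 0 < 1 - x := ⟨hx.1, sub_pos.2 hx.2⟩
  have hαβ : 0 < α + β := by positivity
  have h_means := Real.geom_mean_le_arith_mean2_weighted (w₁ := α / (α + β)) (w₂ := β / (α + β))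
    (p₁ := x / (α / (α + β))) (p₂ := (1 - x) / (β / (α + β)))
    (by positivity) (by positivity) (by positivity) (by positivity) (by field_simp)
  rw [mul_div_cancel₀ _ (by positivity), mul_div_cancel₀ _ (by positivity),
    add_sub_cancel] at h_means
  have h_pow := Real.rpow_le_rpow (by positivity) h_means hαβ.le
  rw [Real.one_rpow, Real.mul_rpow (by positivity) (by positivity), ← Real.rpow_mul (by positivity),
    ← Real.rpow_mul (by positivity), div_mul_cancel₀ _ hαβ.ne', div_mul_cancel₀ _ hαβ.ne',
    Real.div_rpow hx₀.le (by positivity), Real.div_rpow hx₁.le (by positivity), div_mul_div_comm,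
    div_le_one (by positivity)] at h_pow
  rwa [one_sub_div_add hα hβ]

lemma betaPDFReal_le_betaPDFReal_mode (hα : 0 < α) (hβ : 0 < β) (x : ℝ) :
    betaPDFReal (α + 1) (β + 1) x ≤ betaPDFReal (α + 1) (β + 1) (α / (α + β)) := by
  by_cases hx : x ∈ Set.Ioo (0 : ℝ) 1
  · rw [betaPDFReal_add_one_add_one hx, betaPDFReal_add_one_add_one (div_add_mem_Ioo hα hβ)]
    have h_beta := beta_pos (add_pos hα one_pos) (add_pos hβ one_pos)
    exact mul_le_mul_of_nonneg_left (rpow_mul_one_sub_rpow_le hα hβ hx)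
      (one_div_nonneg.2 h_beta.le)
  · rw [betaPDFReal, if_neg (show ¬(0 < x ∧ x < 1) from hx)]
    exact betaPDFReal_nonneg (by positivity) (by positivity) _

lemma exp_neg_one_le_div_add_one_rpow {a : ℝ} (ha : 0 < a) :
    Real.exp (-1) ≤ (a / (a + 1)) ^ a := by
  have h_exp : (a + 1) / a ≤ Real.exp (1 / a) := by
    rw [add_div, div_self ha.ne', add_comm]
    exact Real.add_one_le_exp _
  rw [← inv_div, Real.inv_rpow (by positivity), Real.exp_neg]
  gcongr
  refine (Real.rpow_le_rpow (by positivity) h_exp ha.le).trans_eq ?_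
  rw [← Real.exp_mul, one_div_mul_cancel ha.ne']

lemma exp_neg_one_mul_betaPDFReal_mode_le (hα : 0 < α) (hβ : 0 < β) {m s x : ℝ}
    (hm : m = α / (α + β)) (hs : s = (α + β) / (α + β + 1))
    (hx : x ∈ Set.Ioo (s * m) (s * m + (1 - s))) :
    Real.exp (-1) * betaPDFReal (α + 1) (β + 1) m ≤ betaPDFReal (α + 1) (β + 1) x := by
  have hs_pos : 0 < s := by rw [hs]; positivity
  obtain ⟨hm₀, hm₁⟩ := hm ▸ div_add_mem_Ioo hα hβ
  have hm₁ : 0 < 1 - m := sub_pos.2 hm₁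
  have hx_one_sub : s * (1 - m) < 1 - x := by linarith [hx.2]
  have hx₀ : 0 < x := lt_trans (by positivity) hx.1
  have hx₁ : 0 < 1 - x := lt_trans (by positivity) hx_one_sub
  have h_beta := beta_pos (add_pos hα one_pos) (add_pos hβ one_pos)
  rw [betaPDFReal_add_one_add_one ⟨hm₀, sub_pos.1 hm₁⟩,
    betaPDFReal_add_one_add_one ⟨hx₀, sub_pos.1 hx₁⟩, mul_left_comm]
  refine mul_le_mul_of_nonneg_left ?_ (one_div_nonneg.2 h_beta.le)
  calc Real.exp (-1) * (m ^ α * (1 - m) ^ β)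
      ≤ s ^ (α + β) * (m ^ α * (1 - m) ^ β) := by
        gcongr
        rw [hs]
        exact exp_neg_one_le_div_add_one_rpow (by positivity)
    _ = (s * m) ^ α * (s * (1 - m)) ^ β := by
        rw [Real.mul_rpow hs_pos.le hm₀.le, Real.mul_rpow hs_pos.le hm₁.le, Real.rpow_add hs_pos]
        ring
    _ ≤ x ^ α * (1 - x) ^ β := by
        gcongr
        exact hx.1.le

lemma betaPDFReal_le (hα : 0 < α) (hβ : 0 < β) (x : ℝ) :
    betaPDFReal (α + 1) (β + 1) x ≤ Real.exp 1 * (α + β + 1) := by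
  have hα₁ : 0 < α + 1 := by positivity
  have hβ₁ : 0 < β + 1 := by positivity
  refine (betaPDFReal_le_betaPDFReal_mode hα hβ x).trans ?_
  set m := α / (α + β) with hm
  set s := (α + β) / (α + β + 1) with hs
  have h_length : 1 - s = (α + β + 1)⁻¹ := by
    rw [hs]
    field_simp
    ring
  have h_int := integrable_betaPDFReal hα₁ hβ₁
  have h_mass : (α + β + 1)⁻¹ * (Real.exp (-1) * betaPDFReal (α + 1) (β + 1) m) ≤ 1 :=
    calc (α + β + 1)⁻¹ * (Real.exp (-1) * betaPDFReal (α + 1) (β + 1) m)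
        = ∫ _ in Set.Ioo (s * m) (s * m + (1 - s)),
            Real.exp (-1) * betaPDFReal (α + 1) (β + 1) m := by
          rw [setIntegral_const, measureReal_def, Real.volume_Ioo, add_sub_cancel_left, h_length,
            ENNReal.toReal_ofReal (by positivity), smul_eq_mul]
      _ ≤ ∫ y in Set.Ioo (s * m) (s * m + (1 - s)), betaPDFReal (α + 1) (β + 1) y :=
          setIntegral_mono_on (integrable_const _) h_int.integrableOn measurableSet_Ioo
            fun y hy => exp_neg_one_mul_betaPDFReal_mode_le hα hβ hm hs hy
      _ ≤ ∫ y, betaPDFReal (α + 1) (β + 1) y :=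
          setIntegral_le_integral h_int (ae_of_all _ (betaPDFReal_nonneg hα₁ hβ₁))
      _ = 1 := integral_betaPDFReal hα₁ hβ₁
  rw [Real.exp_neg, ← mul_assoc, ← mul_inv, inv_mul_le_one₀ (by positivity)] at h_mass
  rwa [mul_comm]

lemma betaMeasure_le_smul (hα : 0 < α) (hβ : 0 < β) :
    betaMeasure (α + 1) (β + 1) ≤ ENNReal.ofReal (Real.exp 1 * (α + β + 1)) •
      volume.restrict (Set.Ioo (0 : ℝ) 1) := by
  rw [← withDensity_const, ← withDensity_indicator measurableSet_Ioo, betaMeasure]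
  refine withDensity_mono (ae_of_all _ fun x => ?_)
  by_cases hx : x ∈ Set.Ioo (0 : ℝ) 1
  · rw [Set.indicator_of_mem hx]
    exact ENNReal.ofReal_le_ofReal (betaPDFReal_le hα hβ x)
  · simp only [betaPDF, betaPDFReal, if_neg (show ¬(0 < x ∧ x < 1) from hx), ENNReal.ofReal_zero,
      zero_le]

end BetaDistribution

section ConcentratedBeta

lemma map_volume_Ioo_eq_uniformPrior :
    (volume.restrict (Set.Ioo (0 : ℝ) 1)).map (fun y : ℝ => 2 * y - 1) = uniformPrior := by
  have h_preimage : (fun y : ℝ => 2 * y - 1) ⁻¹' Set.Ioo (-1) 1 = Set.Ioo 0 1 := by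
    ext y
    simp only [Set.mem_preimage, Set.mem_Ioo]
    constructor <;> rintro ⟨h_left, h_right⟩ <;> constructor <;> linarith
  have h_map : volume.map (fun y : ℝ => 2 * y - 1) = ENNReal.ofReal |2⁻¹| • volume := by
    change volume.map ((fun y : ℝ => y - 1) ∘ (2 * ·)) = _
    rw [← Measure.map_map (by fun_prop) (by fun_prop), Real.map_volume_mul_left two_ne_zero,
      Measure.map_smul, (measurePreserving_sub_right volume (1 : ℝ)).map_eq]
  rw [← h_preimage, ← Measure.restrict_map (by fun_prop) measurableSet_Ioo, h_map,
    Measure.restrict_smul, uniformPrior, ProbabilityTheory.cond, Real.volume_Ioo]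
  congr 1
  rw [abs_of_pos (by norm_num), ENNReal.ofReal_inv_of_pos two_pos]
  norm_num

instance isProbabilityMeasure_uniformPrior : IsProbabilityMeasure uniformPrior :=
  cond_isProbabilityMeasure_of_finite (by simp [Real.volume_Ioo]) (by simp [Real.volume_Ioo])

/-- The Beta distribution with mode `θ₀` and concentration `N`, rescaled to `(-1, 1)`: the
posterior approximations `ρ_n` are the case `N = n ^ 4`. -/
noncomputable def concentratedBeta (N θ₀ : ℝ) : Measure ℝ :=
  (betaMeasure (N * ((1 + θ₀) / 2) + 1) (N * ((1 - θ₀) / 2) + 1)).map fun y => 2 * y - 1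

variable {N θ θ₀ δ : ℝ}

lemma concentratedBeta_shape_pos (hN : 0 < N) (hθ₀ : |θ₀| < 1) :
    0 < N * ((1 + θ₀) / 2) ∧ 0 < N * ((1 - θ₀) / 2) := by
  obtain ⟨h_left, h_right⟩ := abs_lt.1 hθ₀
  constructor <;> refine mul_pos hN ?_ <;> linarith

lemma isProbabilityMeasure_concentratedBeta (hN : 0 < N) (hθ₀ : |θ₀| < 1) :
    IsProbabilityMeasure (concentratedBeta N θ₀) := by
  obtain ⟨hα, hβ⟩ := concentratedBeta_shape_pos hN hθ₀
  have := isProbabilityMeasureBeta (add_pos hα one_pos) (add_pos hβ one_pos)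
  exact Measure.isProbabilityMeasure_map (by fun_prop)

lemma concentratedBeta_mem_scaledBetaFamily (hN : 0 < N) (hθ₀ : |θ₀| < 1) :
    concentratedBeta N θ₀ ∈ scaledBetaFamily := by
  obtain ⟨hα, hβ⟩ := concentratedBeta_shape_pos hN hθ₀
  exact ⟨_, _, add_pos hα one_pos, add_pos hβ one_pos, rfl⟩

lemma klDiv_concentratedBeta_le (hN : 0 < N) (hθ₀ : |θ₀| < 1) :
    InformationTheory.klDiv (concentratedBeta N θ₀) uniformPrior ≤
      ENNReal.ofReal (Real.log (Real.exp 1 * (N + 1))) := by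
  obtain ⟨hα, hβ⟩ := concentratedBeta_shape_pos hN hθ₀
  have := isProbabilityMeasure_concentratedBeta hN hθ₀
  have h_le := betaMeasure_le_smul hα hβ
  rw [show N * ((1 + θ₀) / 2) + N * ((1 - θ₀) / 2) = N by ring] at h_le
  refine klDiv_le_log_of_le_smul ?_
  rw [← map_volume_Ioo_eq_uniformPrior, ← Measure.map_smul]
  exact Measure.map_mono h_le (by fun_prop)

lemma klDiv_concentratedBeta_pow_four_le (hθ₀ : |θ₀| < 1) {n : ℕ} (hn : 1 ≤ n) :
    InformationTheory.klDiv (concentratedBeta ((n : ℝ) ^ 4) θ₀) uniformPrior ≤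
      ENNReal.ofReal (8 * √n) := by
  have hn : (1 : ℝ) ≤ n := by exact_mod_cast hn
  refine (klDiv_concentratedBeta_le (by positivity) hθ₀).trans (ENNReal.ofReal_le_ofReal ?_)
  have h_log : Real.log n ≤ 2 * (√n - 1) := by
    have h_log_sqrt := Real.log_le_sub_one_of_pos (show 0 < √(n : ℝ) by positivity)
    rw [Real.log_sqrt (by positivity)] at h_log_sqrt
    linarith
  have h_log_two : Real.log 2 ≤ 1 := (Real.log_le_sub_one_of_pos two_pos).trans (by norm_num)
  calc Real.log (Real.exp 1 * (n ^ 4 + 1))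
      ≤ Real.log (Real.exp 1 * (2 * n ^ 4)) := by
        gcongr
        linarith [one_le_pow₀ hn (n := 4)]
    _ = 1 + (Real.log 2 + 4 * Real.log n) := by
        rw [Real.log_mul (by positivity) (by positivity), Real.log_exp,
          Real.log_mul (by norm_num) (by positivity), Real.log_pow]
        norm_cast
    _ ≤ 8 * √n := by linarith

lemma ae_mem_Ioo_concentratedBeta (N θ₀ : ℝ) :
    ∀ᵐ θ ∂(concentratedBeta N θ₀), θ ∈ Set.Ioo (-1 : ℝ) 1 := by
  refine (ae_map_iff (by fun_prop) measurableSet_Ioo).2 ?_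
  filter_upwards [ae_mem_Ioo_betaMeasure _ _] with y hy
  exact ⟨by linarith [hy.1], by linarith [hy.2]⟩

lemma integral_weight_concentratedBeta (hN : 0 < N) (hθ₀ : |θ₀| < 1) :
    Integrable (fun θ => (θ - θ₀) ^ 2 / (1 - θ ^ 2)) (concentratedBeta N θ₀) ∧
      ∫ θ, (θ - θ₀) ^ 2 / (1 - θ ^ 2) ∂(concentratedBeta N θ₀) = 1 / N := by
  obtain ⟨hα, hβ⟩ := concentratedBeta_shape_pos hN hθ₀
  obtain ⟨h_int, h_eq⟩ := integral_sq_sub_div_betaMeasure hα hβ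
  have h_rescale : ∀ y : ℝ, (2 * y - 1 - θ₀) ^ 2 / (1 - (2 * y - 1) ^ 2) =
      (y - N * ((1 + θ₀) / 2) / (N * ((1 + θ₀) / 2) + N * ((1 - θ₀) / 2))) ^ 2 /
        (y * (1 - y)) := fun y => by
    rw [show N * ((1 + θ₀) / 2) + N * ((1 - θ₀) / 2) = N by ring, mul_div_cancel_left₀ _ hN.ne',
      show 1 - (2 * y - 1) ^ 2 = 4 * (y * (1 - y)) by ring,
      show (2 * y - 1 - θ₀) ^ 2 = 4 * (y - (1 + θ₀) / 2) ^ 2 by ring,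
      mul_div_mul_left _ _ four_ne_zero]
  have h_meas : Measurable fun θ : ℝ => (θ - θ₀) ^ 2 / (1 - θ ^ 2) := by fun_prop
  rw [concentratedBeta, integrable_map_measure h_meas.aestronglyMeasurable (by fun_prop),
    integral_map (by fun_prop) h_meas.aestronglyMeasurable]
  simp only [Function.comp_def, h_rescale]
  exact ⟨h_int, h_eq.trans (by ring)⟩

lemma integral_concentratedBeta_le (hN : 0 < N) (hθ₀ : |θ₀| < 1) {H : ℝ → ℝ} (hH : Measurable H)
    {K : ℝ} (h_le : ∀ θ ∈ Set.Ioo (-1 : ℝ) 1, |H θ| ≤ K * ((θ - θ₀) ^ 2 / (1 - θ ^ 2))) :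
    Integrable H (concentratedBeta N θ₀) ∧ ∫ θ, H θ ∂(concentratedBeta N θ₀) ≤ K / N := by
  obtain ⟨h_int, h_eq⟩ := integral_weight_concentratedBeta hN hθ₀
  have h_ae := (ae_mem_Ioo_concentratedBeta N θ₀).mono h_le
  have hH_int : Integrable H (concentratedBeta N θ₀) :=
    (h_int.const_mul K).mono' hH.aestronglyMeasurable h_ae
  refine ⟨hH_int, (integral_mono_ae hH_int (h_int.const_mul K)
    (h_ae.mono fun θ hθ => (le_abs_self _).trans hθ)).trans_eq ?_⟩
  rw [integral_const_mul, h_eq, mul_one_div]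

lemma sq_sub_le_weight (hθ : |θ| < 1) : (θ - θ₀) ^ 2 ≤ (θ - θ₀) ^ 2 / (1 - θ ^ 2) :=
  le_div_self (sq_nonneg _) (one_sub_sq_pos hθ) (sub_le_self _ (sq_nonneg θ))

lemma abs_sub_rpow_le_weight (hθ₀ : |θ₀| < 1) (hδ : 0 ≤ δ) (hθ : |θ| < 1) :
    |θ - θ₀| ^ (2 + δ) ≤ 2 ^ δ * ((θ - θ₀) ^ 2 / (1 - θ ^ 2)) := by
  have h_abs_sub : |θ - θ₀| ≤ 2 := (abs_sub _ _).trans (by linarith)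
  rw [add_comm, Real.rpow_add_of_nonneg (abs_nonneg _) hδ two_pos.le, Real.rpow_two, sq_abs]
  gcongr
  exact sq_sub_le_weight hθ

/-- The function `f⁽²⁾` in the Lipschitz bound for the log-densities of the invariant laws: twice
the difference of the normalizing terms in these log-densities. -/
noncomputable def invLogDensityGap (θ₂ θ₁ : ℝ) : ℝ := Real.log (1 - θ₁ ^ 2) - Real.log (1 - θ₂ ^ 2)

lemma abs_log_sub_log_le {a u v : ℝ} (ha : 0 < a) (hu : a ≤ u) (hv : a ≤ v) :
    |Real.log u - Real.log v| ≤ |u - v| / a := by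
  have h_one_sided : ∀ {s t : ℝ}, a ≤ s → a ≤ t → Real.log s - Real.log t ≤ |s - t| / a := by
    intro s t hs ht
    have hs_pos := ha.trans_le hs
    have ht_pos := ha.trans_le ht
    calc Real.log s - Real.log t = Real.log (s / t) := (Real.log_div hs_pos.ne' ht_pos.ne').symm
      _ ≤ s / t - 1 := Real.log_le_sub_one_of_pos (by positivity)
      _ = (s - t) / t := div_sub_one ht_pos.ne'
      _ ≤ |s - t| / t := by gcongr; exact le_abs_self _
      _ ≤ |s - t| / a := by gcongr
  exact abs_sub_le_iff.2 ⟨h_one_sided hu hv, abs_sub_comm u v ▸ h_one_sided hv hu⟩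

lemma abs_sq_sub_sq_le (hθ₀ : |θ₀| ≤ 1) (hθ : |θ| ≤ 1) : |θ ^ 2 - θ₀ ^ 2| ≤ 2 * |θ - θ₀| := by
  rw [sq_sub_sq, abs_mul]
  gcongr
  exact (abs_add_le _ _).trans (by linarith)

lemma abs_invLogDensityGap_le (hθ₀ : |θ₀| < 1) (hθ : |θ| < 1)
    (h_near : (1 - θ₀ ^ 2) / 2 ≤ 1 - θ ^ 2) :
    |invLogDensityGap θ θ₀| ≤ 4 / (1 - θ₀ ^ 2) * |θ - θ₀| := by
  have h_pos := one_sub_sq_pos hθ₀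
  have h_log := abs_log_sub_log_le (half_pos h_pos) (half_le_self h_pos.le) h_near
  rw [sub_sub_sub_cancel_left] at h_log
  calc |invLogDensityGap θ θ₀| ≤ |θ ^ 2 - θ₀ ^ 2| / ((1 - θ₀ ^ 2) / 2) := h_log
    _ ≤ 2 * |θ - θ₀| / ((1 - θ₀ ^ 2) / 2) := by
        gcongr
        exact abs_sq_sub_sq_le hθ₀.le hθ.le
    _ = 4 / (1 - θ₀ ^ 2) * |θ - θ₀| := by
        field_simp
        ring

lemma abs_invLogDensityGap_rpow_le (hθ : |θ| < 1) (h_far : 1 - θ ^ 2 ≤ 1 - θ₀ ^ 2) {q : ℝ}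
    (hq : 0 < q) : |invLogDensityGap θ θ₀| ^ q ≤ q ^ q / (1 - θ ^ 2) := by
  have h_pos := one_sub_sq_pos hθ
  have h_log_le : Real.log (1 - θ ^ 2) ≤ Real.log (1 - θ₀ ^ 2) := Real.log_le_log h_pos h_far
  have h_log_nonpos : Real.log (1 - θ₀ ^ 2) ≤ 0 :=
    Real.log_nonpos (h_pos.le.trans h_far) (sub_le_self _ (sq_nonneg θ₀))
  have h_gap : |invLogDensityGap θ θ₀| ≤ q * (1 - θ ^ 2)⁻¹ ^ q⁻¹ :=
    calc |invLogDensityGap θ θ₀| = Real.log (1 - θ₀ ^ 2) - Real.log (1 - θ ^ 2) :=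
          abs_of_nonneg (sub_nonneg.2 h_log_le)
      _ ≤ Real.log (1 - θ ^ 2)⁻¹ := by
          rw [Real.log_inv]
          linarith
      _ ≤ (1 - θ ^ 2)⁻¹ ^ q⁻¹ / q⁻¹ := Real.log_le_rpow_div (by positivity) (by positivity)
      _ = q * (1 - θ ^ 2)⁻¹ ^ q⁻¹ := by rw [div_inv_eq_mul, mul_comm]
  refine (Real.rpow_le_rpow (abs_nonneg _) h_gap hq.le).trans_eq ?_
  rw [Real.mul_rpow hq.le (by positivity), Real.rpow_inv_rpow (by positivity) hq.ne',
    div_eq_mul_inv]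

lemma exists_abs_invLogDensityGap_rpow_le (hθ₀ : |θ₀| < 1) (hδ : 0 ≤ δ) :
    ∃ K : ℝ, 0 ≤ K ∧ ∀ θ : ℝ, |θ| < 1 →
      |invLogDensityGap θ θ₀| ^ (2 + δ) ≤ K * ((θ - θ₀) ^ 2 / (1 - θ ^ 2)) := by
  have h_pos₀ := one_sub_sq_pos hθ₀
  set K₁ := (4 / (1 - θ₀ ^ 2)) ^ (2 + δ) * 2 ^ δ
  set K₂ := (2 + δ) ^ (2 + δ) * (16 / (1 - θ₀ ^ 2) ^ 2)
  refine ⟨max K₁ K₂, by positivity, fun θ hθ => ?_⟩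
  have h_pos := one_sub_sq_pos hθ
  have h_weight : 0 ≤ (θ - θ₀) ^ 2 / (1 - θ ^ 2) := by positivity
  rcases le_or_gt ((1 - θ₀ ^ 2) / 2) (1 - θ ^ 2) with h_near | h_far
  · calc |invLogDensityGap θ θ₀| ^ (2 + δ)
        ≤ (4 / (1 - θ₀ ^ 2) * |θ - θ₀|) ^ (2 + δ) := by
          gcongr
          exact abs_invLogDensityGap_le hθ₀ hθ h_near
      _ = (4 / (1 - θ₀ ^ 2)) ^ (2 + δ) * |θ - θ₀| ^ (2 + δ) :=
          Real.mul_rpow (by positivity) (abs_nonneg _)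
      _ ≤ K₁ * ((θ - θ₀) ^ 2 / (1 - θ ^ 2)) := by
          rw [mul_assoc]
          gcongr
          exact abs_sub_rpow_le_weight hθ₀ hδ hθ
      _ ≤ _ := by gcongr; exact le_max_left _ _
  · have h_dist : (1 - θ₀ ^ 2) / 4 ≤ |θ - θ₀| := by
      linarith [le_abs_self (θ ^ 2 - θ₀ ^ 2), abs_sq_sub_sq_le hθ₀.le hθ.le]
    calc |invLogDensityGap θ θ₀| ^ (2 + δ)
        ≤ (2 + δ) ^ (2 + δ) / (1 - θ ^ 2) :=
          abs_invLogDensityGap_rpow_le hθ (by linarith) (by positivity)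
      _ = K₂ * (((1 - θ₀ ^ 2) / 4) ^ 2 / (1 - θ ^ 2)) := by
          simp only [K₂]
          field_simp
          norm_num
      _ ≤ K₂ * ((θ - θ₀) ^ 2 / (1 - θ ^ 2)) := by
          rw [← sq_abs (θ - θ₀)]
          gcongr
      _ ≤ _ := by gcongr; exact le_max_right _ _

end ConcentratedBeta

section LinearModel

/-- The function `M⁽¹⁾(y, x)` in the Lipschitz bound for the log-densities of the transitions. -/
def ar1Envelope (y x : ℝ) : ℝ := 2 * (1 + x ^ 2 + y ^ 2)

lemma ar1Envelope_pos (y x : ℝ) : 0 < ar1Envelope y x := by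
  rw [ar1Envelope]
  positivity

lemma measurable_ar1Envelope : Measurable (Function.uncurry ar1Envelope) := by
  unfold Function.uncurry ar1Envelope
  fun_prop

variable {θ θ₁ θ₂ θ₀ δ q : ℝ}

lemma log_gaussianPDFReal_mul_sub (θ₁ θ₂ x y : ℝ) :
    Real.log (gaussianPDFReal (θ₁ * x) 1 y) - Real.log (gaussianPDFReal (θ₂ * x) 1 y) =
      (x * y - (θ₁ + θ₂) / 2 * x ^ 2) * (θ₁ - θ₂) := by
  rw [log_gaussianPDFReal _ one_ne_zero, log_gaussianPDFReal _ one_ne_zero, NNReal.coe_one]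
  ring

lemma abs_log_gaussianPDFReal_mul_sub_le (hθ₁ : |θ₁| ≤ 1) (hθ₂ : |θ₂| ≤ 1) (x y : ℝ) :
    |Real.log (gaussianPDFReal (θ₁ * x) 1 y) - Real.log (gaussianPDFReal (θ₂ * x) 1 y)| ≤
      ar1Envelope y x * |θ₂ - θ₁| := by
  have h_mean : |(θ₁ + θ₂) / 2| ≤ 1 := by
    rw [abs_div, abs_two, div_le_one two_pos]
    exact (abs_add_le _ _).trans (by linarith)
  rw [log_gaussianPDFReal_mul_sub, abs_mul, abs_sub_comm θ₁]
  gcongr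
  calc |x * y - (θ₁ + θ₂) / 2 * x ^ 2|
      ≤ |x| * |y| + |(θ₁ + θ₂) / 2| * |x| ^ 2 := by
        rw [← abs_mul, ← abs_pow, ← abs_mul]
        exact abs_sub _ _
    _ ≤ |x| * |y| + |x| ^ 2 := by
        gcongr
        exact mul_le_of_le_one_left (by positivity) h_mean
    _ ≤ ar1Envelope y x := by
        rw [ar1Envelope, ← sq_abs x, ← sq_abs y]
        nlinarith [sq_nonneg (|x| - |y|)]

lemma ar1Envelope_rpow_le (hq : 0 ≤ q) (y x : ℝ) :
    ar1Envelope y x ^ q ≤ 8 ^ q * (1 + |x| ^ (2 * q) + |y| ^ (2 * q)) := by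
  have h_sq : ∀ z : ℝ, (z ^ 2) ^ q = |z| ^ (2 * q) := fun z => by
    rw [← sq_abs, ← Real.rpow_two, ← Real.rpow_mul (abs_nonneg _)]
  have h_one_le : 1 ≤ (2 : ℝ) ^ q := Real.one_le_rpow one_le_two hq
  calc ar1Envelope y x ^ q = 2 ^ q * (1 + x ^ 2 + y ^ 2) ^ q :=
        Real.mul_rpow two_pos.le (by positivity)
    _ ≤ 2 ^ q * (2 ^ q * ((1 + x ^ 2) ^ q + (y ^ 2) ^ q)) := by
        gcongr
        exact add_rpow_le_two_rpow_mul (by positivity) (by positivity) hq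
    _ ≤ 2 ^ q * (2 ^ q * (2 ^ q * (1 + |x| ^ (2 * q)) + 2 ^ q * |y| ^ (2 * q))) := by
        gcongr
        · refine (add_rpow_le_two_rpow_mul one_pos.le (sq_nonneg x) hq).trans_eq ?_
          rw [Real.one_rpow, h_sq]
        · rw [h_sq]
          exact le_mul_of_one_le_left (by positivity) h_one_le
    _ = 8 ^ q * (1 + |x| ^ (2 * q) + |y| ^ (2 * q)) := by
        rw [show (8 : ℝ) = 2 * (2 * 2) by norm_num, Real.mul_rpow two_pos.le (by norm_num),
          Real.mul_rpow two_pos.le two_pos.le]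
        ring

/-- The constant in the bound for the `q`-th moment of the envelope. -/
noncomputable def ar1EnvelopeBound (q : ℝ) : ℝ :=
  8 ^ q * (1 + 2 ^ (2 * q) * (1 + gaussianAbsMoment (2 * q)))

lemma one_le_ar1EnvelopeBound (hq : 0 ≤ q) : 1 ≤ ar1EnvelopeBound q := by
  have h_moment := gaussianAbsMoment_nonneg (2 * q)
  exact one_le_mul_of_one_le_of_one_le (Real.one_le_rpow (by norm_num) hq)
    (le_add_of_nonneg_right (by positivity))

lemma lintegral_ar1Envelope_rpow_le (hq : 0 ≤ q) (hθ : |θ| ≤ 1) (x : ℝ) :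
    ∫⁻ y, ENNReal.ofReal (ar1Envelope y x ^ q) ∂(ar1Kernel θ x) ≤
      ENNReal.ofReal (ar1EnvelopeBound q * (1 + |x| ^ (2 * q))) := by
  have h_moment := gaussianAbsMoment_nonneg (2 * q)
  set r := 2 * q
  have hr : 0 ≤ r := by positivity
  set G := gaussianAbsMoment r
  have h_abs : |θ * x| ^ r ≤ |x| ^ r :=
    Real.rpow_le_rpow (abs_nonneg _)
      ((abs_mul θ x).trans_le (mul_le_of_le_one_left (abs_nonneg x) hθ)) hr
  calc ∫⁻ y, ENNReal.ofReal (ar1Envelope y x ^ q) ∂(ar1Kernel θ x)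
      ≤ ∫⁻ y, ENNReal.ofReal (8 ^ q) * (ENNReal.ofReal (1 + |x| ^ r) +
          ENNReal.ofReal (|y| ^ r)) ∂(ar1Kernel θ x) := by
        refine lintegral_mono fun y => ?_
        rw [← ENNReal.ofReal_add (by positivity) (by positivity),
          ← ENNReal.ofReal_mul (by positivity)]
        exact ENNReal.ofReal_le_ofReal (ar1Envelope_rpow_le hq y x)
    _ = ENNReal.ofReal (8 ^ q) * (ENNReal.ofReal (1 + |x| ^ r) +
          ∫⁻ y, ENNReal.ofReal (|y| ^ r) ∂(gaussianReal (θ * x) 1)) := by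
        rw [lintegral_const_mul _ (by fun_prop), lintegral_add_left (by fun_prop),
          lintegral_const, measure_univ, mul_one, ar1Kernel_apply]
    _ ≤ ENNReal.ofReal (8 ^ q) * (ENNReal.ofReal (1 + |x| ^ r) +
          ENNReal.ofReal (2 ^ r * (|x| ^ r + G))) := by
        gcongr
        refine (lintegral_abs_rpow_gaussianReal_le _ _ hr).trans (ENNReal.ofReal_le_ofReal ?_)
        rw [NNReal.coe_one, Real.sqrt_one, Real.one_rpow, one_mul]
        gcongr
    _ ≤ ENNReal.ofReal (ar1EnvelopeBound q * (1 + |x| ^ r)) := by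
        rw [← ENNReal.ofReal_add (by positivity) (by positivity),
          ← ENNReal.ofReal_mul (by positivity), ar1EnvelopeBound, mul_assoc]
        gcongr
        have h_cross : |x| ^ r + G ≤ (1 + G) * (1 + |x| ^ r) := by
          nlinarith [Real.rpow_nonneg (abs_nonneg x) r]
        linarith [mul_le_mul_of_nonneg_left h_cross (Real.rpow_nonneg two_pos.le r)]

lemma log_gaussianPDFReal_ar1InvVar (hθ : |θ| < 1) (x : ℝ) :
    Real.log (gaussianPDFReal 0 (ar1InvVar θ) x) =
      (Real.log (1 - θ ^ 2) - Real.log (2 * Real.pi) - x ^ 2 * (1 - θ ^ 2)) / 2 := by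
  have h_pos := one_sub_sq_pos hθ
  rw [log_gaussianPDFReal _ (ar1InvVar_pos hθ).ne', coe_ar1InvVar hθ,
    Real.log_mul (by positivity) (by positivity), one_div, Real.log_inv]
  field_simp
  ring

lemma abs_log_gaussianPDFReal_ar1InvVar_sub_le (hθ₁ : |θ₁| < 1) (hθ₂ : |θ₂| < 1) (x : ℝ) :
    |Real.log (gaussianPDFReal 0 (ar1InvVar θ₁) x) -
        Real.log (gaussianPDFReal 0 (ar1InvVar θ₂) x)| ≤
      (1 + x ^ 2) * |invLogDensityGap θ₂ θ₁| := by
  have h_pos₁ := one_sub_sq_pos hθ₁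
  have h_pos₂ := one_sub_sq_pos hθ₂
  have h_sq : |θ₂ ^ 2 - θ₁ ^ 2| ≤ |invLogDensityGap θ₂ θ₁| * 2 := by
    have h_diff := abs_sub_le_abs_log_sub_mul h_pos₁ h_pos₂
    rw [sub_sub_sub_cancel_left] at h_diff
    exact h_diff.trans (mul_le_mul_of_nonneg_left
      (by linarith [sq_nonneg θ₁, sq_nonneg θ₂]) (abs_nonneg _))
  rw [log_gaussianPDFReal_ar1InvVar hθ₁, log_gaussianPDFReal_ar1InvVar hθ₂]
  calc |(Real.log (1 - θ₁ ^ 2) - Real.log (2 * Real.pi) - x ^ 2 * (1 - θ₁ ^ 2)) / 2 -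
        (Real.log (1 - θ₂ ^ 2) - Real.log (2 * Real.pi) - x ^ 2 * (1 - θ₂ ^ 2)) / 2|
      = |invLogDensityGap θ₂ θ₁ - x ^ 2 * (θ₂ ^ 2 - θ₁ ^ 2)| / 2 := by
        rw [← abs_two, ← abs_div, invLogDensityGap]
        ring_nf
    _ ≤ (|invLogDensityGap θ₂ θ₁| + x ^ 2 * |θ₂ ^ 2 - θ₁ ^ 2|) / 2 := by
        gcongr
        refine (abs_sub _ _).trans_eq ?_
        rw [abs_mul, abs_sq]
    _ ≤ (1 + x ^ 2) * |invLogDensityGap θ₂ θ₁| := by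
        linarith [mul_le_mul_of_nonneg_left h_sq (sq_nonneg x),
          abs_nonneg (invLogDensityGap θ₂ θ₁)]

lemma exists_integral_concentratedBeta_lt (hθ₀ : |θ₀| < 1) {H : ℝ → ℝ} (hH : Measurable H) {K : ℝ}
    (hK : 0 ≤ K) (h_le : ∀ θ, |θ| < 1 → |H θ| ≤ K * ((θ - θ₀) ^ 2 / (1 - θ ^ 2))) :
    ∃ C : ℝ, ∀ n : ℕ, 1 ≤ n → Integrable H (concentratedBeta ((n : ℝ) ^ 4) θ₀) ∧
      ∫ θ, H θ ∂(concentratedBeta ((n : ℝ) ^ 4) θ₀) < C / n := by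
  refine ⟨K + 1, fun n hn => ?_⟩
  have hn : (1 : ℝ) ≤ n := by exact_mod_cast hn
  obtain ⟨h_int, h_integral⟩ := integral_concentratedBeta_le (N := (n : ℝ) ^ 4) (by positivity) hθ₀
    hH fun θ hθ => h_le θ (abs_lt.2 hθ)
  refine ⟨h_int, h_integral.trans_lt ?_⟩
  calc K / (n : ℝ) ^ 4 ≤ K / n := by
        gcongr
        exact le_self_pow₀ hn four_ne_zero
    _ < (K + 1) / n := by
        gcongr
        exact lt_add_one K

variable {initRef : Measure ℝ} {q₀ : ℝ → ℝ}

lemma invLaw_simpleLinearModel (hθ : |θ| < 1) :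
    (simpleLinearModel initRef q₀).invLaw θ = gaussianReal 0 (ar1InvVar θ) :=
  (gaussianReal_of_var_ne_zero 0 (ar1InvVar_pos hθ).ne').symm

lemma isConsistent_simpleLinearModel (hq₀_nonneg : ∀ x, 0 ≤ q₀ x) (hq₀ : Measurable q₀)
    [hprob : IsProbabilityMeasure (simpleLinearModel initRef q₀).initLaw] :
    (simpleLinearModel initRef q₀).IsConsistent where
  init_nonneg := hq₀_nonneg
  init_measurable := hq₀
  init_prob := hprob
  trans_nonneg _ _ _ _ := gaussianPDFReal_nonneg _ _ _
  trans_measurable θ _ := by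
    simp only [simpleLinearModel, gaussianPDFReal]
    fun_prop
  kernel_eq θ _ x := gaussianReal_of_var_ne_zero (θ * x) one_ne_zero
  inv_nonneg _ _ _ := gaussianPDFReal_nonneg _ _ _
  inv_measurable _ _ := measurable_gaussianPDFReal _ _
  inv_prob θ hθ := by
    rw [invLaw_simpleLinearModel (abs_lt.2 hθ)]
    infer_instance
  inv_invariant θ hθ := by
    rw [invLaw_simpleLinearModel (abs_lt.2 hθ)]
    exact invariant_ar1Kernel (abs_lt.2 hθ)

lemma genLipschitz_simpleLinearModel (hδ : 0 ≤ δ) (hθ₀ : |θ₀| < 1)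
    [IsProbabilityMeasure (simpleLinearModel initRef q₀).initLaw]
    (h_moment : Integrable (fun x => |x| ^ (2 * (2 + δ)))
      (simpleLinearModel initRef q₀).initLaw) :
    (simpleLinearModel initRef q₀).GenLipschitz θ₀ δ (fun n => concentratedBeta ((n : ℝ) ^ 4) θ₀) 1
      (fun _ => ar1Envelope) (fun _ x => 1 + x ^ 2) (fun _ θ₂ θ₁ => θ₂ - θ₁)
      (fun _ => invLogDensityGap) where
  pos₁ _ := ar1Envelope_pos
  pos₂ _ x := by positivity
  measurable₁ _ := measurable_ar1Envelope
  measurable₂ _ := by fun_prop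
  lip_trans θ₁ hθ₁ θ₂ hθ₂ x y := by
    rw [Fin.sum_univ_one]
    exact abs_log_gaussianPDFReal_mul_sub_le (abs_lt.2 hθ₁).le (abs_lt.2 hθ₂).le x y
  lip_inv θ₁ hθ₁ θ₂ hθ₂ x := by
    rw [Fin.sum_univ_one]
    exact abs_log_gaussianPDFReal_ar1InvVar_sub_le (abs_lt.2 hθ₁) (abs_lt.2 hθ₂) x
  moment_f₁ _ := by
    refine exists_integral_concentratedBeta_lt hθ₀ (by fun_prop) (K := 2 ^ δ) (by positivity)
      fun θ hθ => ?_
    rw [abs_of_nonneg (by positivity)]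
    exact abs_sub_rpow_le_weight hθ₀ hδ hθ
  moment_f₂ _ := by
    obtain ⟨K, hK, h_gap⟩ := exists_abs_invLogDensityGap_rpow_le hθ₀ hδ
    refine exists_integral_concentratedBeta_lt hθ₀ (by unfold invLogDensityGap; fun_prop) hK
      fun θ hθ => ?_
    rw [abs_of_nonneg (by positivity)]
    exact h_gap θ hθ
  moment_M₁ := by
    have h_finite := (((integrable_const 1).add h_moment).const_mul
      (ar1EnvelopeBound (2 + δ))).lintegral_lt_top
    refine ⟨(∫⁻ x, ENNReal.ofReal (ar1EnvelopeBound (2 + δ) * (1 + |x| ^ (2 * (2 + δ))))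
      ∂(simpleLinearModel initRef q₀).initLaw).toReal + 1,
      fun _ θ hθ => (lintegral_mono fun x => lintegral_ar1Envelope_rpow_le (by positivity)
        (abs_lt.2 hθ).le x).trans_lt ?_⟩
    exact (ENNReal.lt_ofReal_iff_toReal_lt h_finite.ne).2 (lt_add_one _)

lemma nonstationaryConditions_simpleLinearModel {Ω : Type*} [MeasurableSpace Ω] {P : Measure Ω}
    {X : ℕ → Ω → ℝ} (hδ : 0 ≤ δ) (hθ₀ : |θ₀| < 1) (hq₀_nonneg : ∀ x, 0 ≤ q₀ x)
    (hq₀ : Measurable q₀) [IsProbabilityMeasure (simpleLinearModel initRef q₀).initLaw]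
    (h_moment : Integrable (fun x => |x| ^ (2 * (2 + δ)))
      (simpleLinearModel initRef q₀).initLaw)
    (hX : HasLaw (fun ω n => X n ω)
      (chainLaw (ar1Kernel θ₀) (simpleLinearModel initRef q₀).initLaw) P) :
    (simpleLinearModel initRef q₀).NonstationaryConditions P X θ₀ δ uniformPrior
      fun n => concentratedBeta ((n : ℝ) ^ 4) θ₀ where
  consistent := isConsistent_simpleLinearModel hq₀_nonneg hq₀
  mem_paramSet := abs_lt.1 hθ₀
  generated := hX
  aperiodic := isAperiodic_ar1Kernel θ₀
  lipschitz_ergodic := by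
    have h_bound := one_le_ar1EnvelopeBound (q := 2 + δ) (by positivity)
    have h_rpow : ∀ x : ℝ, 0 ≤ |x| ^ (2 * (2 + δ)) := fun x => by positivity
    refine ⟨1, _, _, _, _, fun x => (ar1EnvelopeBound (2 + δ) + 1) * (1 + |x| ^ (2 * (2 + δ))),
      genLipschitz_simpleLinearModel hδ hθ₀ h_moment, by fun_prop, fun x => ?_, ?_,
      fun _ x => ?_, ?_⟩
    · exact one_le_mul_of_one_le_of_one_le (by linarith) (le_add_of_nonneg_right (h_rpow x))
    · rw [invLaw_simpleLinearModel hθ₀]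
      exact isVGeometricallyErgodic_ar1Kernel hθ₀ (by positivity) (by positivity)
    · refine (lintegral_ar1Envelope_rpow_le (by positivity) hθ₀.le x).trans_lt ?_
      rw [ENNReal.ofReal_lt_ofReal_iff (by positivity)]
      exact mul_lt_mul_of_pos_right (lt_add_one _) (by positivity)
    · exact (((integrable_const _).add h_moment).const_mul _).lintegral_lt_top
  kl_prior := ⟨8, by norm_num, fun _ hn => klDiv_concentratedBeta_pow_four_le hθ₀ hn⟩

end LinearModel

section PathLogRatio

/-- The logarithm of `p_{θ₀}(y | x) / p_θ(y | x)`. -/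
noncomputable def ar1LogRatio (θ₀ θ x y : ℝ) : ℝ :=
  Real.log (gaussianPDFReal (θ₀ * x) 1 y) - Real.log (gaussianPDFReal (θ * x) 1 y)

lemma ar1Kernel_eq_withDensity (θ₀ θ x : ℝ) :
    ar1Kernel θ₀ x = (ar1Kernel θ x).withDensity
      fun y => ENNReal.ofReal (Real.exp (ar1LogRatio θ₀ θ x y)) := by
  have h_pos : ∀ m y : ℝ, 0 < gaussianPDFReal m 1 y := fun m y =>
    gaussianPDFReal_pos m 1 y one_ne_zero
  rw [ar1Kernel_apply, ar1Kernel_apply, gaussianReal_of_var_ne_zero _ one_ne_zero,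
    gaussianReal_of_var_ne_zero _ one_ne_zero,
    ← withDensity_mul _ (measurable_gaussianPDF _ _)
      (by unfold ar1LogRatio gaussianPDFReal; fun_prop)]
  congr 1 with y
  rw [Pi.mul_apply, gaussianPDF, gaussianPDF, ← ENNReal.ofReal_mul (h_pos _ y).le, ar1LogRatio,
    Real.exp_sub, Real.exp_log (h_pos _ y), Real.exp_log (h_pos _ y),
    mul_div_cancel₀ _ (h_pos _ y).ne']

/-- The logarithm of `∏_{i < n} p_{θ₀}(x_{i+1} | x_i) / p_θ(x_{i+1} | x_i)`. -/
noncomputable def ar1PathLogRatio (θ₀ θ : ℝ) (n : ℕ) (x : Fin (n + 1) → ℝ) : ℝ :=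
  ∑ i : Fin n, ar1LogRatio θ₀ θ (x i.castSucc) (x i.succ)

lemma measurable_uncurry_ar1PathLogRatio (θ₀ : ℝ) (n : ℕ) :
    Measurable (Function.uncurry fun θ => ar1PathLogRatio θ₀ θ n) := by
  unfold Function.uncurry ar1PathLogRatio ar1LogRatio gaussianPDFReal
  fun_prop

lemma measurable_ar1PathLogRatio (θ₀ θ : ℝ) (n : ℕ) : Measurable (ar1PathLogRatio θ₀ θ n) :=
  (measurable_uncurry_ar1PathLogRatio θ₀ n).of_uncurry_left

lemma transitionProd_exp_ar1LogRatio (θ₀ θ : ℝ) (n : ℕ) :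
    transitionProd (fun x y => ENNReal.ofReal (Real.exp (ar1LogRatio θ₀ θ x y))) n =
      fun x => ENNReal.ofReal (Real.exp (ar1PathLogRatio θ₀ θ n x)) := by
  funext x
  rw [transitionProd, ar1PathLogRatio, Real.exp_sum,
    ENNReal.ofReal_prod_of_nonneg fun _ _ => (Real.exp_pos _).le]

lemma map_initialSegment_chainLaw_ar1Kernel_eq_withDensity (θ₀ θ : ℝ) (ν : Measure ℝ)
    [IsProbabilityMeasure ν] (n : ℕ) :
    (chainLaw (ar1Kernel θ₀) ν).map (initialSegment n) =
      ((chainLaw (ar1Kernel θ) ν).map (initialSegment n)).withDensity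
        fun x => ENNReal.ofReal (Real.exp (ar1PathLogRatio θ₀ θ n x)) := by
  rw [← transitionProd_exp_ar1LogRatio]
  refine (isMarkovChain_chainLaw _ ν).map_initialSegment_eq_withDensity
    (isMarkovChain_chainLaw _ ν) (by rw [map_zero_chainLaw, map_zero_chainLaw]) ?_
    (ar1Kernel_eq_withDensity θ₀ θ) n
  unfold ar1LogRatio gaussianPDFReal
  fun_prop

/-- The sum of the envelopes of the transitions along a path. -/
def envelopeSum (n : ℕ) (x : Fin (n + 1) → ℝ) : ℝ :=
  ∑ i : Fin n, ar1Envelope (x i.succ) (x i.castSucc)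

lemma measurable_envelopeSum (n : ℕ) : Measurable (envelopeSum n) := by
  unfold envelopeSum ar1Envelope
  fun_prop

lemma envelopeSum_nonneg (n : ℕ) (x : Fin (n + 1) → ℝ) : 0 ≤ envelopeSum n x :=
  Finset.sum_nonneg fun _ _ => (ar1Envelope_pos _ _).le

lemma abs_ar1PathLogRatio_le {θ₀ θ : ℝ} (hθ₀ : |θ₀| ≤ 1) (hθ : |θ| ≤ 1) (n : ℕ)
    (x : Fin (n + 1) → ℝ) : |ar1PathLogRatio θ₀ θ n x| ≤ |θ - θ₀| * envelopeSum n x := by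
  rw [ar1PathLogRatio, envelopeSum, mul_comm, Finset.sum_mul]
  exact (Finset.abs_sum_le_sum_abs _ _).trans
    (Finset.sum_le_sum fun i _ => abs_log_gaussianPDFReal_mul_sub_le hθ₀ hθ _ _)

lemma sq_envelopeSum_le (n : ℕ) (x : Fin (n + 1) → ℝ) :
    envelopeSum n x ^ 2 ≤
      n * ∑ i : Fin n, 12 * (1 + |x i.castSucc| ^ (4 : ℝ) + |x i.succ| ^ (4 : ℝ)) := by
  have h_four : ∀ z : ℝ, |z| ^ (4 : ℝ) = (z ^ 2) ^ 2 := fun z => by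
    rw [← sq_abs z, ← pow_mul]
    exact Real.rpow_natCast |z| 4
  have h_cauchy := sq_sum_le_card_mul_sum_sq (s := (Finset.univ : Finset (Fin n)))
    (f := fun i => ar1Envelope (x i.succ) (x i.castSucc))
  rw [Finset.card_univ, Fintype.card_fin] at h_cauchy
  refine h_cauchy.trans ?_
  gcongr with i
  rw [h_four, h_four, ar1Envelope]
  nlinarith [sq_nonneg (x i.castSucc ^ 2 - x i.succ ^ 2), sq_nonneg (x i.castSucc ^ 2 - 1),
    sq_nonneg (x i.succ ^ 2 - 1)]

lemma integral_sq_envelopeSum_le {n : ℕ} {m : ℝ} {μ : Measure (Fin (n + 1) → ℝ)}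
    [IsProbabilityMeasure μ] (h_int : ∀ i, Integrable (fun x => |x i| ^ (4 : ℝ)) μ)
    (h_le : ∀ i, ∫ x, |x i| ^ (4 : ℝ) ∂μ ≤ m) :
    Integrable (fun x => envelopeSum n x ^ 2) μ ∧
      ∫ x, envelopeSum n x ^ 2 ∂μ ≤ 12 * (1 + m + m) * n ^ 2 := by
  have h_one_add : ∀ i : Fin (n + 1), Integrable (fun x => 1 + |x i| ^ (4 : ℝ)) μ := fun i =>
    (integrable_const 1).add (h_int i)
  have h_term : ∀ i : Fin n, Integrable
      (fun x => 12 * (1 + |x i.castSucc| ^ (4 : ℝ) + |x i.succ| ^ (4 : ℝ))) μ := fun i =>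
    ((h_one_add _).add (h_int _)).const_mul 12
  have h_dom := (integrable_finsetSum Finset.univ fun i _ => h_term i).const_mul (n : ℝ)
  have h_sq : Integrable (fun x => envelopeSum n x ^ 2) μ :=
    h_dom.mono' ((measurable_envelopeSum n).pow_const 2).aestronglyMeasurable
      (ae_of_all _ fun x => (Real.norm_of_nonneg (sq_nonneg _)).trans_le (sq_envelopeSum_le n x))
  refine ⟨h_sq, ?_⟩
  calc ∫ x, envelopeSum n x ^ 2 ∂μ
      ≤ n * ∑ i : Fin n, ∫ x, 12 * (1 + |x i.castSucc| ^ (4 : ℝ) + |x i.succ| ^ (4 : ℝ)) ∂μ := by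
        rw [← integral_finsetSum _ fun i _ => h_term i, ← integral_const_mul]
        exact integral_mono h_sq h_dom (sq_envelopeSum_le n)
    _ ≤ n * ∑ _i : Fin n, 12 * (1 + m + m) := by
        gcongr with i
        rw [integral_const_mul, integral_add (h_one_add _) (h_int _),
          integral_add (integrable_const 1) (h_int _), integral_const, probReal_univ, one_smul]
        gcongr <;> exact h_le _
    _ = 12 * (1 + m + m) * n ^ 2 := by
        rw [Finset.sum_const, Finset.card_univ, Fintype.card_fin, nsmul_eq_mul]
        ring

variable {θ₀ p : ℝ} {ν : Measure ℝ} [IsProbabilityMeasure ν]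

lemma isProbabilityMeasure_map_initialSegment_chainLaw (θ : ℝ) (n : ℕ) :
    IsProbabilityMeasure ((chainLaw (ar1Kernel θ) ν).map (initialSegment n)) :=
  Measure.isProbabilityMeasure_map (measurable_initialSegment n).aemeasurable

lemma integrable_abs_rpow_apply_chainLaw_and_integral_le (hθ₀ : |θ₀| < 1) (hp : 0 ≤ p)
    (hν : Integrable (fun x => |x| ^ p) ν) (i : ℕ) :
    Integrable (fun ω : ℕ → ℝ => |ω i| ^ p) (chainLaw (ar1Kernel θ₀) ν) ∧
      ∫ ω, |ω i| ^ p ∂(chainLaw (ar1Kernel θ₀) ν) ≤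
        ∫ x, ar1MomentBound θ₀ p * (1 + |x| ^ p) ∂ν := by
  have h_bound := ar1MomentBound_nonneg θ₀ p
  have h_nonneg : 0 ≤ᵐ[chainLaw (ar1Kernel θ₀) ν] fun ω => |ω i| ^ p :=
    ae_of_all _ fun ω => by positivity
  have h_meas : Measurable fun ω : ℕ → ℝ => |ω i| ^ p := by fun_prop
  have h_dom : Integrable (fun x => ar1MomentBound θ₀ p * (1 + |x| ^ p)) ν :=
    ((integrable_const 1).add hν).const_mul _
  have h_lintegral : ∫⁻ ω, ENNReal.ofReal (|ω i| ^ p) ∂(chainLaw (ar1Kernel θ₀) ν) ≤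
      ENNReal.ofReal (∫ x, ar1MomentBound θ₀ p * (1 + |x| ^ p) ∂ν) := by
    rw [← lintegral_map (f := fun y : ℝ => ENNReal.ofReal (|y| ^ p)) (by fun_prop)
      (measurable_pi_apply i), (isMarkovChain_chainLaw _ ν).map_apply, map_zero_chainLaw,
      Measure.lintegral_bind (Kernel.aemeasurable _) (by fun_prop),
      ofReal_integral_eq_lintegral_ofReal h_dom (ae_of_all _ fun x => by positivity)]
    exact lintegral_mono fun x => lintegral_abs_rpow_pow_ar1Kernel_le hθ₀ hp i x
  refine ⟨⟨h_meas.aestronglyMeasurable, ?_⟩, ?_⟩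
  · rw [hasFiniteIntegral_iff_ofReal h_nonneg]
    exact h_lintegral.trans_lt ENNReal.ofReal_lt_top
  · rw [integral_eq_lintegral_of_nonneg_ae h_nonneg h_meas.aestronglyMeasurable]
    exact ENNReal.toReal_le_of_le_ofReal (integral_nonneg fun x => by positivity) h_lintegral

lemma exists_integral_sq_envelopeSum_le (hθ₀ : |θ₀| < 1)
    (hν : Integrable (fun x => |x| ^ (4 : ℝ)) ν) :
    ∃ K : ℝ, 0 ≤ K ∧ ∀ n : ℕ,
      Integrable (fun x => envelopeSum n x ^ 2)
        ((chainLaw (ar1Kernel θ₀) ν).map (initialSegment n)) ∧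
      ∫ x, envelopeSum n x ^ 2 ∂((chainLaw (ar1Kernel θ₀) ν).map (initialSegment n)) ≤
        K * n ^ 2 := by
  have h_bound := ar1MomentBound_nonneg θ₀ 4
  set m := ∫ x, ar1MomentBound θ₀ 4 * (1 + |x| ^ (4 : ℝ)) ∂ν
  have hm : 0 ≤ m := integral_nonneg fun x => by positivity
  refine ⟨12 * (1 + m + m), by positivity, fun n => ?_⟩
  have h_prob := isProbabilityMeasure_map_initialSegment_chainLaw (ν := ν) θ₀ n
  have h_coord : ∀ i : Fin (n + 1),
      Integrable (fun x => |x i| ^ (4 : ℝ)) ((chainLaw (ar1Kernel θ₀) ν).map (initialSegment n)) ∧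
      ∫ x, |x i| ^ (4 : ℝ) ∂((chainLaw (ar1Kernel θ₀) ν).map (initialSegment n)) ≤ m := fun i => by
    have h_meas : Measurable fun x : Fin (n + 1) → ℝ => |x i| ^ (4 : ℝ) := by fun_prop
    rw [integrable_map_measure h_meas.aestronglyMeasurable
      (measurable_initialSegment n).aemeasurable,
      integral_map (measurable_initialSegment n).aemeasurable h_meas.aestronglyMeasurable]
    exact integrable_abs_rpow_apply_chainLaw_and_integral_le hθ₀ (by norm_num) hν i
  exact integral_sq_envelopeSum_le (fun i => (h_coord i).1) fun i => (h_coord i).2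

end PathLogRatio

section MeanVariance

variable {θ₀ θ : ℝ} {n : ℕ} {Q : Measure (Fin (n + 1) → ℝ)}

lemma memLp_ar1PathLogRatio (hθ₀ : |θ₀| ≤ 1) (hθ : |θ| ≤ 1) (hQ : MemLp (envelopeSum n) 2 Q) :
    MemLp (ar1PathLogRatio θ₀ θ n) 2 Q :=
  hQ.of_le_mul (measurable_ar1PathLogRatio θ₀ θ n).aestronglyMeasurable
    (ae_of_all _ fun x => by
      rw [Real.norm_eq_abs, Real.norm_of_nonneg (envelopeSum_nonneg n x)]
      exact abs_ar1PathLogRatio_le hθ₀ hθ n x)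

lemma integral_sq_ar1PathLogRatio_le (hθ₀ : |θ₀| ≤ 1) (hθ : |θ| ≤ 1)
    (hQ : MemLp (envelopeSum n) 2 Q) :
    ∫ x, ar1PathLogRatio θ₀ θ n x ^ 2 ∂Q ≤ (∫ x, envelopeSum n x ^ 2 ∂Q) * (θ - θ₀) ^ 2 := by
  rw [← integral_mul_const]
  refine integral_mono (memLp_ar1PathLogRatio hθ₀ hθ hQ).integrable_sq
    (hQ.integrable_sq.mul_const _) fun x => ?_
  dsimp only
  rw [← sq_abs, ← sq_abs (θ - θ₀), ← mul_pow, mul_comm]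
  exact pow_le_pow_left₀ (abs_nonneg _) (abs_ar1PathLogRatio_le hθ₀ hθ n x) 2

variable [IsProbabilityMeasure Q]

lemma variance_ar1PathLogRatio_le (hθ₀ : |θ₀| ≤ 1) (hθ : |θ| ≤ 1)
    (hQ : MemLp (envelopeSum n) 2 Q) :
    variance (ar1PathLogRatio θ₀ θ n) Q ≤ (∫ x, envelopeSum n x ^ 2 ∂Q) * (θ - θ₀) ^ 2 :=
  (variance_le_expectation_sq (measurable_ar1PathLogRatio θ₀ θ n).aestronglyMeasurable).trans
    (integral_sq_ar1PathLogRatio_le hθ₀ hθ hQ)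

lemma abs_integral_ar1PathLogRatio_le (hθ₀ : |θ₀| ≤ 1) (hθ : |θ| ≤ 1)
    (hQ : MemLp (envelopeSum n) 2 Q) :
    |∫ x, ar1PathLogRatio θ₀ θ n x ∂Q| ≤
      (1 + (∫ x, envelopeSum n x ^ 2 ∂Q) * (θ - θ₀) ^ 2) / 2 := by
  have h_variance := variance_nonneg (ar1PathLogRatio θ₀ θ n) Q
  rw [variance_eq_sub (memLp_ar1PathLogRatio hθ₀ hθ hQ)] at h_variance
  have h_mean_sq := (sub_nonneg.1 h_variance).trans (integral_sq_ar1PathLogRatio_le hθ₀ hθ hQ)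
  rw [← sq_abs] at h_mean_sq
  linarith [two_mul_le_add_sq 1 |∫ x, ar1PathLogRatio θ₀ θ n x ∂Q|]

lemma stronglyMeasurable_integral_ar1PathLogRatio (θ₀ : ℝ) (n : ℕ)
    (Q : Measure (Fin (n + 1) → ℝ)) [SFinite Q] :
    StronglyMeasurable fun θ => ∫ x, ar1PathLogRatio θ₀ θ n x ∂Q :=
  (measurable_uncurry_ar1PathLogRatio θ₀ n).stronglyMeasurable.integral_prod_right

variable {ρ : Measure ℝ}

lemma integrable_variance_ar1PathLogRatio (hθ₀ : |θ₀| ≤ 1) (hQ : MemLp (envelopeSum n) 2 Q)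
    (hρ : ∀ᵐ θ ∂ρ, |θ| ≤ 1) (hρ_sq : Integrable (fun θ => (θ - θ₀) ^ 2) ρ) :
    Integrable (fun θ => variance (ar1PathLogRatio θ₀ θ n) Q) ρ := by
  have h_sq : StronglyMeasurable fun θ => ∫ x, ar1PathLogRatio θ₀ θ n x ^ 2 ∂Q :=
    ((measurable_uncurry_ar1PathLogRatio θ₀ n).pow_const 2).stronglyMeasurable.integral_prod_right
  refine (hρ_sq.const_mul (∫ x, envelopeSum n x ^ 2 ∂Q)).mono' ?_ ?_
  · refine (h_sq.sub ((stronglyMeasurable_integral_ar1PathLogRatio θ₀ n Q).pow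
      2)).aestronglyMeasurable.congr ?_
    filter_upwards [hρ] with θ hθ
    exact (variance_eq_sub (memLp_ar1PathLogRatio hθ₀ hθ hQ)).symm
  · filter_upwards [hρ] with θ hθ
    rw [Real.norm_of_nonneg (variance_nonneg _ _)]
    exact variance_ar1PathLogRatio_le hθ₀ hθ hQ

lemma integral_variance_ar1PathLogRatio_le (hθ₀ : |θ₀| ≤ 1) (hQ : MemLp (envelopeSum n) 2 Q)
    (hρ : ∀ᵐ θ ∂ρ, |θ| ≤ 1) (hρ_sq : Integrable (fun θ => (θ - θ₀) ^ 2) ρ) :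
    ∫ θ, variance (ar1PathLogRatio θ₀ θ n) Q ∂ρ ≤
      (∫ x, envelopeSum n x ^ 2 ∂Q) * ∫ θ, (θ - θ₀) ^ 2 ∂ρ := by
  rw [← integral_const_mul]
  exact integral_mono_ae (integrable_variance_ar1PathLogRatio hθ₀ hQ hρ hρ_sq)
    (hρ_sq.const_mul _) (hρ.mono fun θ hθ => variance_ar1PathLogRatio_le hθ₀ hθ hQ)

lemma integrable_integral_ar1PathLogRatio [IsFiniteMeasure ρ] (hθ₀ : |θ₀| ≤ 1)
    (hQ : MemLp (envelopeSum n) 2 Q) (hρ : ∀ᵐ θ ∂ρ, |θ| ≤ 1)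
    (hρ_sq : Integrable (fun θ => (θ - θ₀) ^ 2) ρ) :
    Integrable (fun θ => ∫ x, ar1PathLogRatio θ₀ θ n x ∂Q) ρ :=
  (((integrable_const 1).add (hρ_sq.const_mul _)).div_const 2).mono'
    (stronglyMeasurable_integral_ar1PathLogRatio θ₀ n Q).aestronglyMeasurable
    (hρ.mono fun _ hθ => abs_integral_ar1PathLogRatio_le hθ₀ hθ hQ)

lemma integral_integral_ar1PathLogRatio_le [IsProbabilityMeasure ρ] (hθ₀ : |θ₀| ≤ 1)
    (hQ : MemLp (envelopeSum n) 2 Q) (hρ : ∀ᵐ θ ∂ρ, |θ| ≤ 1)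
    (hρ_sq : Integrable (fun θ => (θ - θ₀) ^ 2) ρ) :
    ∫ θ, ∫ x, ar1PathLogRatio θ₀ θ n x ∂Q ∂ρ ≤
      (1 + (∫ x, envelopeSum n x ^ 2 ∂Q) * ∫ θ, (θ - θ₀) ^ 2 ∂ρ) / 2 := by
  have h_dom := hρ_sq.const_mul (∫ x, envelopeSum n x ^ 2 ∂Q)
  calc ∫ θ, ∫ x, ar1PathLogRatio θ₀ θ n x ∂Q ∂ρ
      ≤ ∫ θ, (1 + (∫ x, envelopeSum n x ^ 2 ∂Q) * (θ - θ₀) ^ 2) / 2 ∂ρ :=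
        integral_mono_ae (integrable_integral_ar1PathLogRatio hθ₀ hQ hρ hρ_sq)
          (((integrable_const 1).add h_dom).div_const 2) (hρ.mono fun θ hθ =>
            (le_abs_self _).trans (abs_integral_ar1PathLogRatio_le hθ₀ hθ hQ))
    _ = (1 + (∫ x, envelopeSum n x ^ 2 ∂Q) * ∫ θ, (θ - θ₀) ^ 2 ∂ρ) / 2 := by
        rw [integral_div, integral_add (integrable_const 1) h_dom, integral_const_mul,
          integral_const, probReal_univ, one_smul]

lemma klDiv_map_initialSegment_chainLaw_ar1Kernel {ν : Measure ℝ} [IsProbabilityMeasure ν]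
    (h_int : Integrable (ar1PathLogRatio θ₀ θ n)
      ((chainLaw (ar1Kernel θ₀) ν).map (initialSegment n))) :
    InformationTheory.klDiv ((chainLaw (ar1Kernel θ₀) ν).map (initialSegment n))
        ((chainLaw (ar1Kernel θ) ν).map (initialSegment n)) =
      ENNReal.ofReal (∫ x, ar1PathLogRatio θ₀ θ n x
        ∂((chainLaw (ar1Kernel θ₀) ν).map (initialSegment n))) ∧
    0 ≤ ∫ x, ar1PathLogRatio θ₀ θ n x ∂((chainLaw (ar1Kernel θ₀) ν).map (initialSegment n)) := by
  have h_prob₀ := isProbabilityMeasure_map_initialSegment_chainLaw (ν := ν) θ₀ n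
  have h_prob := isProbabilityMeasure_map_initialSegment_chainLaw (ν := ν) θ n
  exact klDiv_withDensity_exp (measurable_ar1PathLogRatio θ₀ θ n)
    (map_initialSegment_chainLaw_ar1Kernel_eq_withDensity θ₀ θ ν n) h_int

lemma lintegral_klDiv_map_initialSegment_chainLaw_ar1Kernel {ν : Measure ℝ}
    [IsProbabilityMeasure ν] (hθ₀ : |θ₀| ≤ 1)
    (h_env : MemLp (envelopeSum n) 2 ((chainLaw (ar1Kernel θ₀) ν).map (initialSegment n)))
    (hρ : ∀ᵐ θ ∂ρ, |θ| ≤ 1)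
    (h_int : Integrable (fun θ => ∫ x, ar1PathLogRatio θ₀ θ n x
      ∂((chainLaw (ar1Kernel θ₀) ν).map (initialSegment n))) ρ) :
    ∫⁻ θ, InformationTheory.klDiv ((chainLaw (ar1Kernel θ₀) ν).map (initialSegment n))
        ((chainLaw (ar1Kernel θ) ν).map (initialSegment n)) ∂ρ =
      ENNReal.ofReal (∫ θ, ∫ x, ar1PathLogRatio θ₀ θ n x
        ∂((chainLaw (ar1Kernel θ₀) ν).map (initialSegment n)) ∂ρ) := by
  have h_kl := hρ.mono fun θ hθ => klDiv_map_initialSegment_chainLaw_ar1Kernel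
    ((memLp_ar1PathLogRatio hθ₀ hθ h_env).integrable one_le_two)
  rw [ofReal_integral_eq_lintegral_ofReal h_int (h_kl.mono fun _ h => h.2)]
  exact lintegral_congr_ae (h_kl.mono fun _ h => h.1)

end MeanVariance

section PACBayes

variable {initRef : Measure ℝ} {q₀ : ℝ → ℝ} {θ₀ : ℝ} {n : ℕ}

lemma logRatio_simpleLinearModel (θ θ₀ : ℝ) {x : Fin (n + 1) → ℝ} (hx : q₀ (x 0) ≠ 0) :
    (simpleLinearModel initRef q₀).logRatio n θ θ₀ x = ar1PathLogRatio θ₀ θ n x := by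
  have h_ne : ∀ m y : ℝ, gaussianPDFReal m 1 y ≠ 0 := fun m y =>
    (gaussianPDFReal_pos m 1 y one_ne_zero).ne'
  simp only [Model.logRatio, Model.pathDensity, simpleLinearModel]
  rw [mul_div_mul_left _ _ hx, ← Finset.prod_div_distrib,
    Real.log_prod fun i _ => div_ne_zero (h_ne _ _) (h_ne _ _)]
  exact Finset.sum_congr rfl fun i _ => Real.log_div (h_ne _ _) (h_ne _ _)

lemma logRatio_simpleLinearModel_ae_eq (hq₀ : Measurable q₀) (θ θ₀ : ℝ) (n : ℕ) :
    (simpleLinearModel initRef q₀).logRatio n θ θ₀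
      =ᵐ[(simpleLinearModel initRef q₀).pathLaw θ₀ n] ar1PathLogRatio θ₀ θ n := by
  have h_init : ∀ᵐ x ∂(simpleLinearModel initRef q₀).initLaw, q₀ x ≠ 0 := by
    refine (ae_withDensity_iff hq₀.ennreal_ofReal).2 (ae_of_all _ fun x hx h_zero => hx ?_)
    exact ENNReal.ofReal_of_nonpos h_zero.le
  rw [← map_zero_chainLaw (ar1Kernel θ₀) (simpleLinearModel initRef q₀).initLaw] at h_init
  have h_set : MeasurableSet {x : Fin (n + 1) → ℝ | q₀ (x 0) ≠ 0} :=
    hq₀.comp (measurable_pi_apply 0) (measurableSet_singleton 0).compl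
  have h_path : ∀ᵐ x ∂(simpleLinearModel initRef q₀).pathLaw θ₀ n, q₀ (x 0) ≠ 0 :=
    (ae_map_iff (measurable_initialSegment n).aemeasurable h_set).2
      (ae_of_ae_map (measurable_pi_apply 0).aemeasurable h_init)
  exact h_path.mono fun x hx => logRatio_simpleLinearModel θ θ₀ hx

lemma pacBayesConditions_simpleLinearModel (hθ₀ : |θ₀| ≤ 1) (hq₀ : Measurable q₀)
    [IsProbabilityMeasure (simpleLinearModel initRef q₀).initLaw]
    (h_env : MemLp (envelopeSum n) 2 ((simpleLinearModel initRef q₀).pathLaw θ₀ n))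
    {π ρ : Measure ℝ} [IsProbabilityMeasure ρ] (hρ : ∀ᵐ θ ∂ρ, θ ∈ Set.Ioo (-1) 1)
    (hρ_sq : Integrable (fun θ => (θ - θ₀) ^ 2) ρ) {ε : ℝ}
    (hε : 1 + (∫ x, envelopeSum n x ^ 2 ∂((simpleLinearModel initRef q₀).pathLaw θ₀ n)) *
      ∫ θ, (θ - θ₀) ^ 2 ∂ρ ≤ n * ε)
    (hkl : InformationTheory.klDiv ρ π ≤ ENNReal.ofReal (n * ε)) :
    (simpleLinearModel initRef q₀).PACBayesConditions θ₀ π n ρ ε := by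
  have h_prob : IsProbabilityMeasure ((simpleLinearModel initRef q₀).pathLaw θ₀ n) :=
    isProbabilityMeasure_map_initialSegment_chainLaw θ₀ n
  have h_ae := fun θ => logRatio_simpleLinearModel_ae_eq (initRef := initRef) hq₀ θ θ₀ n
  have h_mean := fun θ => integral_congr_ae (h_ae θ)
  have h_var := fun θ => variance_congr (h_ae θ)
  have hρ_le : ∀ᵐ θ ∂ρ, |θ| ≤ 1 := hρ.mono fun θ hθ => (abs_lt.2 hθ).le
  have h_int := integrable_integral_ar1PathLogRatio hθ₀ h_env hρ_le hρ_sq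
  have h_nonneg : 0 ≤ (∫ x, envelopeSum n x ^ 2 ∂((simpleLinearModel initRef q₀).pathLaw θ₀ n)) *
      ∫ θ, (θ - θ₀) ^ 2 ∂ρ :=
    mul_nonneg (integral_nonneg fun _ => sq_nonneg _) (integral_nonneg fun _ => sq_nonneg _)
  exact
    { memLp := fun θ hθ =>
        (memLp_congr_ae (h_ae θ)).2 (memLp_ar1PathLogRatio hθ₀ (abs_lt.2 hθ).le h_env)
      integrable_mean := by simpa only [h_mean] using h_int
      kl_eq := by
        simp only [h_mean]
        exact lintegral_klDiv_map_initialSegment_chainLaw_ar1Kernel hθ₀ h_env hρ_le h_int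
      mean_le := by
        simp only [h_mean]
        linarith [integral_integral_ar1PathLogRatio_le hθ₀ h_env hρ_le hρ_sq]
      integrable_var := by
        simpa only [h_var] using integrable_variance_ar1PathLogRatio hθ₀ h_env hρ_le hρ_sq
      var_le := by
        simp only [h_var]
        linarith [integral_variance_ar1PathLogRatio_le hθ₀ h_env hρ_le hρ_sq]
      kl_prior_le := hkl }

end PACBayes

section Rate

variable {initRef : Measure ℝ} {q₀ : ℝ → ℝ} {θ₀ : ℝ} {n : ℕ}

lemma integral_sq_sub_concentratedBeta_le {N : ℝ} (hN : 0 < N) (hθ₀ : |θ₀| < 1) :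
    Integrable (fun θ => (θ - θ₀) ^ 2) (concentratedBeta N θ₀) ∧
      ∫ θ, (θ - θ₀) ^ 2 ∂(concentratedBeta N θ₀) ≤ 1 / N := by
  refine integral_concentratedBeta_le hN hθ₀ (by fun_prop) fun θ hθ => ?_
  rw [abs_of_nonneg (sq_nonneg _), one_mul]
  exact sq_sub_le_weight (abs_lt.2 hθ)

lemma pacBayesConditions_concentratedBeta (hθ₀ : |θ₀| < 1) (hq₀ : Measurable q₀)
    [IsProbabilityMeasure (simpleLinearModel initRef q₀).initLaw] (hn : 1 ≤ n) {K : ℝ}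
    (hK : 0 ≤ K)
    (h_int : Integrable (fun x => envelopeSum n x ^ 2)
      ((simpleLinearModel initRef q₀).pathLaw θ₀ n))
    (h_le : ∫ x, envelopeSum n x ^ 2 ∂((simpleLinearModel initRef q₀).pathLaw θ₀ n) ≤
      K * n ^ 2) :
    (simpleLinearModel initRef q₀).PACBayesConditions θ₀ uniformPrior n
      (concentratedBeta ((n : ℝ) ^ 4) θ₀) ((8 + K) / √n) := by
  have hn_cast : (1 : ℝ) ≤ n := by exact_mod_cast hn
  have h_pow : (0 : ℝ) < (n : ℝ) ^ 4 := by positivity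
  have h_sqrt : 1 ≤ √(n : ℝ) := Real.one_le_sqrt.2 hn_cast
  have h_rate : (n : ℝ) * ((8 + K) / √n) = (8 + K) * √n := by
    rw [mul_div_left_comm, Real.div_sqrt]
  have hρ_prob := isProbabilityMeasure_concentratedBeta h_pow hθ₀
  obtain ⟨h_sq, h_sq_le⟩ := integral_sq_sub_concentratedBeta_le h_pow hθ₀
  have h_var : (∫ x, envelopeSum n x ^ 2 ∂((simpleLinearModel initRef q₀).pathLaw θ₀ n)) *
      ∫ θ, (θ - θ₀) ^ 2 ∂(concentratedBeta ((n : ℝ) ^ 4) θ₀) ≤ K :=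
    calc _ ≤ K * n ^ 2 * (1 / (n : ℝ) ^ 4) := by gcongr
      _ = K / (n : ℝ) ^ 2 := by field_simp
      _ ≤ K := div_le_self hK (one_le_pow₀ hn_cast)
  refine pacBayesConditions_simpleLinearModel hθ₀.le hq₀
    ((memLp_two_iff_integrable_sq (measurable_envelopeSum n).aestronglyMeasurable).2 h_int)
    (ae_mem_Ioo_concentratedBeta _ _) h_sq ?_ ?_
  · rw [h_rate]
    nlinarith
  · rw [h_rate]
    refine (klDiv_concentratedBeta_pow_four_le hθ₀ hn).trans (ENNReal.ofReal_le_ofReal ?_)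
    gcongr
    exact le_add_of_nonneg_right hK

lemma integrable_abs_rpow_of_le {ν : Measure ℝ} [IsFiniteMeasure ν] {p q : ℝ} (hp : 0 ≤ p)
    (hpq : p ≤ q) (hq : Integrable (fun x => |x| ^ q) ν) : Integrable (fun x => |x| ^ p) ν := by
  refine ((integrable_const 1).add hq).mono' (by fun_prop : Measurable _).aestronglyMeasurable
    (ae_of_all _ fun x => ?_)
  rw [Real.norm_of_nonneg (by positivity), Pi.add_apply]
  rcases le_total |x| 1 with h_small | h_large
  · exact (Real.rpow_le_one (abs_nonneg x) h_small hp).trans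
      (le_add_of_nonneg_right (by positivity))
  · exact (Real.rpow_le_rpow_of_exponent_le h_large hpq).trans (le_add_of_nonneg_left one_pos.le)

end Rate

end MarkovVB

theorem mainTheorem11_general {Ω : Type*} [MeasurableSpace Ω] (P : Measure Ω)
    [IsProbabilityMeasure P] (δ θ₀ : ℝ) (hδ : 0 ≤ δ) (hθ₀ : |θ₀| < 1) (X W : ℕ → Ω → ℝ)
    (hW : ∀ n, HasLaw (W n) (gaussianReal 0 1) P)
    (hW_indep : iIndepFun W P)
    (hX_W : IndepFun (X 0) (fun ω n => W n ω) P)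
    (hX : ∀ n ω, X (n + 1) ω = θ₀ * X n ω + W n ω)
    (initRef : Measure ℝ) (q₀ : ℝ → ℝ) (hq₀_nonneg : ∀ x, 0 ≤ q₀ x) (hq₀ : Measurable q₀)
    (hX₀ : HasLaw (X 0) (initRef.withDensity (fun x => ENNReal.ofReal (q₀ x))) P)
    (hmoment : Integrable (fun ω => |X 0 ω| ^ (4 + 2 * δ)) P) :
    ∃ ρ : ℕ → Measure ℝ, (∀ n, 1 ≤ n → ρ n ∈ scaledBetaFamily) ∧
      (simpleLinearModel initRef q₀).NonstationaryConditions P X θ₀ δ uniformPrior ρ ∧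
      ∃ ε : ℕ → ℝ, (∀ n, 1 ≤ n → 0 < ε n) ∧
        (∀ n, 1 ≤ n →
          (simpleLinearModel initRef q₀).PACBayesConditions θ₀ uniformPrior n (ρ n) (ε n)) ∧
        ε =O[atTop] fun n : ℕ => 1 / √(n : ℝ) := by
  have h_init : IsProbabilityMeasure (simpleLinearModel initRef q₀).initLaw :=
    hX₀.isProbabilityMeasure_iff.1 inferInstance
  have h_moment : Integrable (fun x => |x| ^ (2 * (2 + δ)))
      (simpleLinearModel initRef q₀).initLaw := by
    rw [show 2 * (2 + δ) = 4 + 2 * δ by ring, Model.initLaw, simpleLinearModel, ← hX₀.map_eq]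
    exact (integrable_map_measure (by fun_prop : Measurable _).aestronglyMeasurable
      hX₀.aemeasurable).2 hmoment
  have h_fourth := integrable_abs_rpow_of_le (p := 4) (by norm_num) (by linarith) h_moment
  obtain ⟨K, hK, h_env⟩ := exists_integral_sq_envelopeSum_le hθ₀ h_fourth
  refine ⟨fun n => concentratedBeta ((n : ℝ) ^ 4) θ₀, fun n hn =>
    concentratedBeta_mem_scaledBetaFamily (by positivity) hθ₀,
    nonstationaryConditions_simpleLinearModel hδ hθ₀ hq₀_nonneg hq₀ h_moment
      (hasLaw_chainLaw_of_recursion hW hX₀ hW_indep hX_W hX),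
    fun n => (8 + K) / √n, fun n hn => by positivity, fun n hn =>
    pacBayesConditions_concentratedBeta hθ₀ hq₀ hn hK (h_env n).1 (h_env n).2, ?_⟩
  simpa only [div_eq_mul_one_div (8 + K)] using isBigO_const_mul_self (8 + K) _ _

theorem mainTheorem11 {Ω : Type*} [MeasurableSpace Ω] (P : Measure Ω) [IsProbabilityMeasure P]
    (δ θ₀ : ℝ) (hδ : 0 < δ) (hθ₀ : |θ₀| < (2 : ℝ) ^ (1 / (4 + 2 * δ) - 1))
    (X W : ℕ → Ω → ℝ)
    (hW : ∀ n, HasLaw (W n) (gaussianReal 0 1) P)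
    (hW_indep : iIndepFun W P)
    (hX_W : IndepFun (X 0) (fun ω n => W n ω) P)
    (hX : ∀ n ω, X (n + 1) ω = θ₀ * X n ω + W n ω)
    (initRef : Measure ℝ) (q₀ : ℝ → ℝ) (hq₀_nonneg : ∀ x, 0 ≤ q₀ x) (hq₀ : Measurable q₀)
    (hX₀ : HasLaw (X 0) (initRef.withDensity (fun x => ENNReal.ofReal (q₀ x))) P)
    (hmoment : Integrable (fun ω => |X 0 ω| ^ (4 + 2 * δ)) P) :
    ∃ ρ : ℕ → Measure ℝ, (∀ n, 1 ≤ n → ρ n ∈ scaledBetaFamily) ∧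
      (simpleLinearModel initRef q₀).NonstationaryConditions P X θ₀ δ uniformPrior ρ ∧
      ∃ ε : ℕ → ℝ, (∀ n, 1 ≤ n → 0 < ε n) ∧
        (∀ n, 1 ≤ n →
          (simpleLinearModel initRef q₀).PACBayesConditions θ₀ uniformPrior n (ρ n) (ε n)) ∧
        ε =O[atTop] fun n : ℕ => max (1 / √(n : ℝ)) ((n : ℝ) ^ (δ / 2) / n) := by
  have h_bound : (2 : ℝ) ^ (1 / (4 + 2 * δ) - 1) ≤ 1 :=
    Real.rpow_le_one_of_one_le_of_nonpos one_le_two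
      (sub_nonpos.2 (div_le_one_of_le₀ (by linarith) (by linarith)))
  obtain ⟨ρ, hρ, h_cond, ε, hε, h_pac, h_rate⟩ := mainTheorem11_general P δ θ₀ hδ.le
    (hθ₀.trans_le h_bound) X W hW hW_indep hX_W hX initRef q₀ hq₀_nonneg hq₀ hX₀ hmoment
  exact ⟨ρ, hρ, h_cond, ε, hε, h_pac, h_rate.trans <| IsBigO.of_norm_le fun n =>
    (Real.norm_of_nonneg (by positivity)).trans_le (le_max_left _ _)⟩
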